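/- **Theorem (Rule of Signs).** Let $\beta\neq0$, let $(\beta_p)_{p\ge2}$ be real numbers that are not all zero, and suppose that the series $\xi(t)=\beta^2\sum_{p\ge2}\beta_p^2t^p$ satisfies $\xi(1+\epsilon)<\infty$ for some $\epsilon>0$. Let $h\ge0$. Let $X$ be the space of functions $\eta\in C^1([0,1))$ such that $\eta'$ is locally Lipschitz on $[0,1)$ (so that $\eta''$ exists almost everywhere), and let $$\Lambda=\{\eta\in X:\ \eta\ge\xi\text{ on }[0,1),\ \eta'(0)=-h^2,\ \eta''\ge0\text{ a.e.}\}.$$ For $\eta\in\Lambda$ define $D(\eta)\in[-\infty,\infty)$ by $$D(\eta)=\frac12\left(\int_0^1\Big(2\sqrt{\eta''(s)}-\eta''(s)(1-s)-\frac1{1-s}\Big)ds-\eta(0)+h^2+\xi(1)\right),$$ where the integrand is non-positive. Let $\eta\in\Lambda$ be optimal, i.e. $D(\eta)=\max_{\Lambda}D$. Let $\{\eta=\xi\}=\{s\in[0,1):\eta(s)=\xi(s)\}$ be the coincidence set, let $\mathfrak d=\left(1/\sqrt{\xi''}\right)''$, and let $0\le a<b<1$. 1. If $\mathfrak d>0$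 on $(a,b)$, then $\{\eta=\xi\}\cap[a,b]$ has at most two elements. 2. If $\mathfrak d\le0$ on $[a,b]$ and $a,b\in\{\eta=\xi\}$, then $[a,b]\subset\{\eta=\xi\}$. -/

import Mathlib

open Set MeasureTheory
open scoped ENNReal

/-- The mixture `ξ(t) = β² ∑_{p ≥ 2} β_p² t^p`, with `β_p = c p`. -/
noncomputable def mixture (β : ℝ) (c : ℕ → ℝ) (t : ℝ) : ℝ :=
  β ^ 2 * ∑' p : ℕ, c (p + 2) ^ 2 * t ^ (p + 2)

/-- `𝔡 = (1 / √ξ'')''`. -/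
noncomputable def signFn (ξ : ℝ → ℝ) : ℝ → ℝ :=
  deriv (deriv fun t => 1 / Real.sqrt (deriv (deriv ξ) t))

/-- The derivative of a function on `[0,1)` (one-sided at `0`). Functions on `[0,1)` are represented
by functions on `ℝ`, and only their values on `[0,1)` are ever used. -/
noncomputable def der (η : ℝ → ℝ) : ℝ → ℝ := derivWithin η (Ico 0 1)

/-- The second derivative `η''` on `[0,1)`. When `η'` is locally Lipschitz, it exists almost
everywhere and represents the second distributional derivative. -/
noncomputable def der2 (η : ℝ → ℝ) : ℝ → ℝ := der (der η)

/-- The space `X` of functions `η ∈ C¹([0,1))` with `η'` locally Lipschitz on `[0,1)`. -/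
def spaceX : Set (ℝ → ℝ) :=
  {η | ContDiffOn ℝ 1 η (Ico 0 1) ∧ LocallyLipschitzOn (Ico 0 1) (der η)}

/-- The admissible set `Λ_{ξ,h}` of the dual problem. -/
def admissible (ξ : ℝ → ℝ) (h : ℝ) : Set (ℝ → ℝ) :=
  {η | η ∈ spaceX ∧ (∀ s ∈ Ico (0 : ℝ) 1, ξ s ≤ η s) ∧ der η 0 = -h ^ 2 ∧
    ∀ᵐ s ∂(volume.restrict (Ico (0 : ℝ) 1)), 0 ≤ der2 η s}

/-- The integrand `2 √η'' - η'' (1 - s) - 1 / (1 - s)` of the dual functional. It is non-positive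
wherever `η'' ≥ 0`. -/
noncomputable def dualIntegrand (η : ℝ → ℝ) (s : ℝ) : ℝ :=
  2 * Real.sqrt (der2 η s) - der2 η s * (1 - s) - 1 / (1 - s)

/-- The dual functional `D_{ξ,h}` with values in `[-∞, ∞)`. As the integrand is non-positive a.e.
on the admissible set, its integral is minus the Lebesgue integral of its negative. -/
noncomputable def dualFunctional (ξ : ℝ → ℝ) (h : ℝ) (η : ℝ → ℝ) : EReal :=
  ((1 / 2 : ℝ) : EReal) *
    (-((∫⁻ s in Ico (0 : ℝ) 1, ENNReal.ofReal (-dualIntegrand η s) : ℝ≥0∞) : EReal)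
      + ((-η 0 + h ^ 2 + ξ 1 : ℝ) : EReal))

/-- `η` is optimal for the dual problem: it maximizes `D_{ξ,h}` over `Λ_{ξ,h}`. -/
def IsDualOptimal (ξ : ℝ → ℝ) (h : ℝ) (η : ℝ → ℝ) : Prop :=
  η ∈ admissible ξ h ∧ ∀ ζ ∈ admissible ξ h, dualFunctional ξ h ζ ≤ dualFunctional ξ h η

/-- The coincidence set `{s ∈ [0,1) : η(s) = ξ(s)}`. -/
def coincidenceSet (ξ η : ℝ → ℝ) : Set ℝ := {s | s ∈ Ico (0 : ℝ) 1 ∧ η s = ξ s}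

/-! The optimality of `η` is tested with variations `η + ε φ`, where `φ'' = ψ` is bounded, supported
in an interval `(l, r)` of `[0,1)` and orthogonal to affine functions. Then `φ` vanishes outside
`(l, r)`, the values `η 0` and `η' 0` are kept, the term `ψ (1 - s)` integrates to zero, and the
first variation is formally `∫ ψ / √η''`. Since `η''` is unknown and may vanish, it is replaced by a
comparison function `v`: if `η'' ≤ v` where `ψ > 0` and `η'' ≥ v` where `ψ < 0`, concavity of the
square root still gives `∫ ψ / √v ≤ 0` (`IsDualOptimal.integral_div_sqrt_nonpos`).

The test functions have signs `+, -, +` on three successive sets of positive measure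
(`exists_isConvexityTest`). Comparing with a chord shows that such a `ψ` integrates non-negatively
against convex functions, and positively against strictly convex ones. As `φ s = ∫ (s - t)⁺ ψ t`,
also `φ ≥ 0`.

Part 1: between consecutive points of three coincidences, `η - ξ` has a critical point by Rolle, and
the middle coincidence is a minimum. Hence `η'' ≤ ξ''` on a set of positive measure on each side of
it, with `η'' ≥ ξ''` on such a set in between. With `v = ξ''`, strict convexity of `1 / √ξ''`
contradicts optimality.

Part 2: on a gap between coincidences, `η - ξ` rises from zero and returns to it, so `η'' - ξ''`
shows the signs `+, -, +`. The variation `-ψ` is admissible because `η - ξ` is bounded below inside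
the gap. Concavity alone yields only a weak inequality; strictness comes from a set where `η'' ≤ ρ
ξ''` with `ρ < 1`. -/

/-! ### Power series and the regularity of the mixture -/

/-- The sum of the power series with coefficients `a`. -/
noncomputable def powerSum (a : ℕ → ℝ) (t : ℝ) : ℝ := ∑' n, a n * t ^ n

/-- The coefficients of the termwise derivative of a power series. -/
def derivCoeff (a : ℕ → ℝ) (n : ℕ) : ℝ := (n + 1) * a (n + 1)

/-- The power series with coefficients `a ≥ 0` converges at a point beyond `1`. -/
def ConvergesBeyondOne (a : ℕ → ℝ) : Prop :=
  (∀ n, 0 ≤ a n) ∧ ∃ R : ℝ, 1 < R ∧ Summable fun n => a n * R ^ n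

/-- After shrinking the radius from `R` to `r`, the factor `n` is absorbed: `n (r / R) ^ n` is
bounded, so the differentiated series is dominated by the original one at `R`. -/
theorem ConvergesBeyondOne.exists_summable_deriv {a : ℕ → ℝ} (ha : ConvergesBeyondOne a) :
    ∃ r : ℝ, 1 < r ∧ (Summable fun n : ℕ => (n : ℝ) * a n * r ^ (n - 1)) ∧
      Summable fun n => a n * r ^ n := by
  obtain ⟨ha0, R, hR, hs⟩ := ha
  obtain ⟨r, hr1, hrR⟩ := exists_between hR
  have hr0 : 0 < r := by linarith
  have hR0 : 0 < R := by linarith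
  refine ⟨r, hr1, ?_, ?_⟩
  · have hq : Summable fun n : ℕ => (n : ℝ) * (r / R) ^ n := by
      have := summable_pow_mul_geometric_of_norm_lt_one (R := ℝ) 1 (r := r / R) (by
        rw [Real.norm_of_nonneg (by positivity)]; exact (div_lt_one hR0).2 hrR)
      simpa using this
    obtain ⟨B, hB⟩ := hq.tendsto_atTop_zero.bddAbove_range
    refine Summable.of_nonneg_of_le (fun n => by have := ha0 n; positivity) ?_
      (hs.mul_left (B / r))
    intro n
    have hBn : (n : ℝ) * (r / R) ^ n ≤ B := hB ⟨n, rfl⟩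
    rcases n with _ | n
    · simp only [Nat.cast_zero, zero_mul, pow_zero] at hBn ⊢
      have := ha0 0
      positivity
    · have h1 : ((n + 1 : ℕ) : ℝ) * r ^ (n + 1) ≤ B * R ^ (n + 1) := by
        rw [div_pow, ← mul_div_assoc, div_le_iff₀ (by positivity)] at hBn
        exact hBn
      have : ((n + 1 : ℕ) : ℝ) * a (n + 1) * r ^ (n + 1 - 1)
          = a (n + 1) / r * (((n + 1 : ℕ) : ℝ) * r ^ (n + 1)) := by
        field_simp
        simp [pow_succ, mul_assoc]
      rw [this]
      calc _ ≤ a (n + 1) / r * (B * R ^ (n + 1)) := by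
            have := ha0 (n + 1)
            gcongr
        _ = _ := by ring
  · refine Summable.of_nonneg_of_le (fun n => by have := ha0 n; positivity) ?_ hs
    intro n
    have := ha0 n
    gcongr

theorem ConvergesBeyondOne.derivCoeff {a : ℕ → ℝ} (ha : ConvergesBeyondOne a) :
    ConvergesBeyondOne (derivCoeff a) := by
  obtain ⟨r, hr, hs, -⟩ := ha.exists_summable_deriv
  refine ⟨fun n => mul_nonneg (by positivity) (ha.1 _), r, hr, ?_⟩
  have := (summable_nat_add_iff 1).2 hs
  simpa [_root_.derivCoeff] using this

theorem ConvergesBeyondOne.hasDerivAt {a : ℕ → ℝ} (ha : ConvergesBeyondOne a) {t : ℝ}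
    (ht : |t| ≤ 1) : HasDerivAt (powerSum a) (powerSum (_root_.derivCoeff a) t) t := by
  obtain ⟨r, hr, hs, hs'⟩ := ha.exists_summable_deriv
  have htr : t ∈ Ioo (-r) r := by
    rw [abs_le] at ht
    constructor <;> linarith
  have h0 : (0 : ℝ) ∈ Ioo (-r) r := by constructor <;> linarith
  have hbd : ∀ (n : ℕ) (y : ℝ), y ∈ Ioo (-r) r →
      ‖a n * ((n : ℝ) * y ^ (n - 1))‖ ≤ (n : ℝ) * a n * r ^ (n - 1) := by
    intro n y hy
    have hy' : |y| ≤ r := abs_le.2 ⟨hy.1.le, hy.2.le⟩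
    have := ha.1 n
    rw [norm_mul, norm_mul, norm_pow, Real.norm_of_nonneg this, Real.norm_eq_abs y,
      Real.norm_of_nonneg (Nat.cast_nonneg n)]
    calc a n * (n * |y| ^ (n - 1)) = n * a n * |y| ^ (n - 1) := by ring
      _ ≤ _ := by gcongr
  have key := hasDerivAt_tsum_of_isPreconnected hs isOpen_Ioo (isPreconnected_Ioo)
    (g := fun n y => a n * y ^ n) (g' := fun n y => a n * ((n : ℝ) * y ^ (n - 1)))
    (fun n y _ => (hasDerivAt_pow n y).const_mul (a n)) hbd h0
    (by
      refine summable_of_ne_finset_zero (s := {0}) ?_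
      intro n hn
      have : n ≠ 0 := by simpa using hn
      simp [this]) htr
  have hsum : Summable fun n : ℕ => a n * ((n : ℝ) * t ^ (n - 1)) :=
    Summable.of_norm_bounded hs fun n => hbd n t htr
  have heq : powerSum (_root_.derivCoeff a) t = ∑' n : ℕ, a n * ((n : ℝ) * t ^ (n - 1)) := by
    rw [hsum.tsum_eq_zero_add]
    simp only [powerSum, _root_.derivCoeff]
    simp only [Nat.cast_zero, zero_mul, mul_zero, zero_add, Nat.add_sub_cancel]
    refine tsum_congr fun n => ?_
    push_cast
    ring
  rw [heq]
  exact key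

theorem ConvergesBeyondOne.contDiffOn {a : ℕ → ℝ} (ha : ConvergesBeyondOne a) (n : ℕ) :
    ContDiffOn ℝ n (powerSum a) (Ioo (-1) 1) := by
  have hd : ∀ {a : ℕ → ℝ}, ConvergesBeyondOne a → ∀ t ∈ Ioo (-1 : ℝ) 1,
      HasDerivAt (powerSum a) (powerSum (_root_.derivCoeff a) t) t := fun ha t ht =>
    ha.hasDerivAt (abs_le.2 ⟨ht.1.le, ht.2.le⟩)
  induction n generalizing a with
  | zero =>
    exact contDiffOn_zero.2 fun t ht => (hd ha t ht).continuousAt.continuousWithinAt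
  | succ n ih =>
    push_cast
    rw [contDiffOn_succ_iff_deriv_of_isOpen isOpen_Ioo]
    refine ⟨fun t ht => (hd ha t ht).differentiableAt.differentiableWithinAt, ?_, ?_⟩
    · simp
    · exact (ih ha.derivCoeff).congr fun t ht => (hd ha t ht).deriv

theorem ConvergesBeyondOne.powerSum_pos {a : ℕ → ℝ} (ha : ConvergesBeyondOne a) {n : ℕ}
    (hn : a n ≠ 0) {t : ℝ} (ht0 : 0 < t) (ht1 : t ≤ 1) : 0 < powerSum a t := by
  obtain ⟨ha0, R, hR, hs⟩ := ha
  have hst : Summable fun n => a n * t ^ n := by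
    refine Summable.of_nonneg_of_le (fun n => by have := ha0 n; positivity) ?_ hs
    intro n
    have := ha0 n
    have : t ≤ R := by linarith
    gcongr
  refine hst.tsum_pos (fun n => by have := ha0 n; positivity) n ?_
  have := lt_of_le_of_ne (ha0 n) (Ne.symm hn)
  positivity

/-- The properties of a mixture on which the rule of signs depends. -/
structure IsRegularMixture (ξ : ℝ → ℝ) : Prop where
  contDiffOn : ContDiffOn ℝ 4 ξ (Ioo (-1) 1)
  deriv_zero : deriv ξ 0 = 0
  deriv2_pos : ∀ t ∈ Ioo (0 : ℝ) 1, 0 < deriv (deriv ξ) t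
  bounded : ∃ M, ∀ t ∈ Ico (0 : ℝ) 1, ξ t ≤ M

theorem mixture_eq_powerSum (β : ℝ) (c : ℕ → ℝ) :
    mixture β c = powerSum (fun n => if 2 ≤ n then β ^ 2 * c n ^ 2 else 0) := by
  funext t
  unfold mixture powerSum
  rw [← tsum_mul_left]
  symm
  have hinj : Function.Injective fun p : ℕ => p + 2 := fun a b hab => by simpa using hab
  rw [← hinj.tsum_eq]
  · refine tsum_congr fun p => ?_
    simp [mul_assoc]
  · intro n hn
    by_cases h : 2 ≤ n
    · exact ⟨n - 2, by simp [h]⟩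
    · simp [h] at hn

theorem isRegularMixture_mixture (β : ℝ) (hβ : β ≠ 0) (c : ℕ → ℝ)
    (hc : ∃ p : ℕ, 2 ≤ p ∧ c p ≠ 0)
    (hconv : ∃ ε : ℝ, 0 < ε ∧ Summable fun p : ℕ => c (p + 2) ^ 2 * (1 + ε) ^ (p + 2)) :
    IsRegularMixture (mixture β c) := by
  set a : ℕ → ℝ := fun n => if 2 ≤ n then β ^ 2 * c n ^ 2 else 0 with hadef
  have ha : ConvergesBeyondOne a := by
    refine ⟨fun n => ?_, ?_⟩
    · simp only [hadef]
      split_ifs <;> positivity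
    · obtain ⟨ε, hε, hs⟩ := hconv
      refine ⟨1 + ε, by linarith, ?_⟩
      rw [← summable_nat_add_iff 2]
      refine (hs.mul_left (β ^ 2)).congr fun p => ?_
      simp [hadef, mul_assoc]
  rw [mixture_eq_powerSum]
  have hd : ∀ {a : ℕ → ℝ}, ConvergesBeyondOne a → ∀ t ∈ Ioo (-1 : ℝ) 1,
      deriv (powerSum a) t = powerSum (_root_.derivCoeff a) t := fun ha t ht =>
    (ha.hasDerivAt (abs_le.2 ⟨ht.1.le, ht.2.le⟩)).deriv
  refine ⟨mod_cast ha.contDiffOn 4, ?_, ?_, ?_⟩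
  · rw [hd ha 0 (by norm_num)]
    unfold powerSum
    rw [tsum_eq_single 0 (fun n hn => by simp [hn])]
    simp [_root_.derivCoeff, hadef]
  · intro t ht
    have ht' : t ∈ Ioo (-1 : ℝ) 1 := ⟨by linarith [ht.1], ht.2⟩
    have : deriv (deriv (powerSum a)) t = powerSum (_root_.derivCoeff (_root_.derivCoeff a)) t := by
      rw [← hd ha.derivCoeff t ht']
      refine Filter.EventuallyEq.deriv_eq ?_
      filter_upwards [Ioo_mem_nhds ht'.1 ht'.2] with s hs using hd ha s hs
    rw [this]
    obtain ⟨p, hp, hcp⟩ := hc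
    refine ha.derivCoeff.derivCoeff.powerSum_pos (n := p - 2) ?_ ht.1 ht.2.le
    obtain ⟨q, rfl⟩ := Nat.exists_eq_add_of_le' hp
    simp only [_root_.derivCoeff, Nat.add_sub_cancel, hadef]
    have h2 : 2 ≤ q + 1 + 1 := by omega
    rw [if_pos h2]
    have : (0 : ℝ) < q + 1 := by positivity
    push_cast
    positivity
  · have hcont : ContinuousOn (powerSum a) (Icc 0 1) := fun t ht =>
      (ha.hasDerivAt (abs_le.2 ⟨by linarith [ht.1], ht.2⟩)).continuousAt.continuousWithinAt
    obtain ⟨M, hM⟩ := isCompact_Icc.bddAbove_image hcont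
    exact ⟨M, fun t ht => hM ⟨t, Ico_subset_Icc_self ht, rfl⟩⟩

/-! ### Monotonicity from almost everywhere information -/

section AbsolutelyContinuous

variable {F : ℝ → ℝ} {x y : ℝ}

theorem AbsolutelyContinuousOnInterval.le_of_ae_deriv_nonneg
    (hF : AbsolutelyContinuousOnInterval F x y) (hxy : x ≤ y)
    (hd : ∀ᵐ s, s ∈ Ioo x y → 0 ≤ deriv F s) : F x ≤ F y := by
  have h := hF.integral_deriv_eq_sub
  have h0 : 0 ≤ ∫ s in x..y, deriv F s := by
    refine intervalIntegral.integral_nonneg_of_ae_restrict hxy ?_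
    rw [← restrict_Ioo_eq_restrict_Icc]
    exact (ae_restrict_iff' measurableSet_Ioo).2 hd
  linarith

theorem AbsolutelyContinuousOnInterval.lt_of_ae_deriv_pos
    (hF : AbsolutelyContinuousOnInterval F x y) (hxy : x < y)
    (hd : ∀ᵐ s, s ∈ Ioo x y → 0 < deriv F s) : F x < F y := by
  have h := hF.integral_deriv_eq_sub
  have hd' : ∀ᵐ s ∂volume.restrict (Ioc x y), 0 < deriv F s := by
    rw [← restrict_Ioo_eq_restrict_Ioc]
    exact (ae_restrict_iff' measurableSet_Ioo).2 hd
  have h0 : ∫ _ in x..y, (0 : ℝ) < ∫ s in x..y, deriv F s := by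
    refine intervalIntegral.integral_lt_integral_of_ae_le_of_measure_setOfPred_lt_ne_zero hxy.le
      (by simp) hF.intervalIntegrable_deriv (hd'.mono fun s hs => hs.le) ?_
    intro hz
    have : volume.restrict (Ioc x y) univ = 0 := by
      refine measure_mono_null (t := {s | 0 < deriv F s} ∪ {s | ¬ 0 < deriv F s}) ?_ ?_
      · intro s _
        exact em _
      · exact measure_union_null hz hd'
    simp only [Measure.restrict_apply_univ, Real.volume_Ioc, ENNReal.ofReal_eq_zero] at this
    linarith
  simp only [intervalIntegral.integral_zero] at h0
  linarith

end AbsolutelyContinuous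

/-- Exhaustion by countably many smaller intervals. The room gained at the endpoints separates the
supports of the test functions and keeps them compactly inside a gap. -/
theorem exists_Ioo_measure_inter_ne_zero {S : Set ℝ} {a b : ℝ}
    (h : volume (S ∩ Ioo a b) ≠ 0) :
    ∃ a' b', a < a' ∧ a' < b' ∧ b' < b ∧ volume (S ∩ Ioo a' b') ≠ 0 := by
  by_contra! hcon
  apply h
  have hsub : S ∩ Ioo a b ⊆ ⋃ n : ℕ, S ∩ Ioo (a + 1 / (n + 1)) (b - 1 / (n + 1)) := by
    rintro s ⟨hs, hsa, hsb⟩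
    obtain ⟨n, hn⟩ := exists_nat_one_div_lt (lt_min (sub_pos.2 hsa) (sub_pos.2 hsb))
    have h1 := lt_of_lt_of_le hn (min_le_left _ _)
    have h2 := lt_of_lt_of_le hn (min_le_right _ _)
    exact mem_iUnion.2 ⟨n, hs, by linarith, by linarith⟩
  refine measure_mono_null hsub (measure_iUnion_null fun n => ?_)
  have hn : (0 : ℝ) < 1 / (n + 1) := by positivity
  rcases lt_or_ge (a + 1 / ((n : ℝ) + 1)) (b - 1 / (n + 1)) with hlt | hge
  · exact hcon _ _ (by linarith) hlt (by linarith)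
  · rw [Ioo_eq_empty_of_le hge, inter_empty, measure_empty]

/-! ### Derivatives of `η - ξ` and sets where `η''` and `ξ''` compare -/

section Derivatives

variable {η ξ : ℝ → ℝ} {s x y : ℝ}

theorem hasDerivWithinAt_der (hη : ContDiffOn ℝ 1 η (Ico 0 1)) (hs : s ∈ Ico (0 : ℝ) 1) :
    HasDerivWithinAt η (der η s) (Ico 0 1) s :=
  ((hη.differentiableOn (by norm_num)) s hs).hasDerivWithinAt

theorem hasDerivAt_der (hη : ContDiffOn ℝ 1 η (Ico 0 1)) (hs : s ∈ Ioo (0 : ℝ) 1) :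
    HasDerivAt η (der η s) s :=
  (hasDerivWithinAt_der hη (Ioo_subset_Ico_self hs)).hasDerivAt (Ico_mem_nhds hs.1 hs.2)

theorem der2_eq_deriv (η : ℝ → ℝ) (hs : s ∈ Ioo (0 : ℝ) 1) : der2 η s = deriv (der η) s :=
  derivWithin_of_mem_nhds (Ico_mem_nhds hs.1 hs.2)

theorem absolutelyContinuousOnInterval_der (hη : η ∈ spaceX) (hx : x ∈ Ico (0 : ℝ) 1)
    (hy : y ∈ Ico (0 : ℝ) 1) : AbsolutelyContinuousOnInterval (der η) x y := by
  have hsub : uIcc x y ⊆ Ico 0 1 := ordConnected_Ico.uIcc_subset hx hy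
  obtain ⟨K, hK⟩ := (hη.2.mono hsub).exists_lipschitzOnWith_of_compact isCompact_uIcc
  exact hK.absolutelyContinuousOnInterval

/-- The Lipschitz bound is only local, so almost everywhere differentiability is obtained on compact
intervals exhausting `[0,1)`. -/
theorem ae_hasDerivAt_der (hη : η ∈ spaceX) :
    ∀ᵐ s, s ∈ Ioo (0 : ℝ) 1 → HasDerivAt (der η) (der2 η s) s := by
  have h : ∀ n : ℕ, ∀ᵐ s, s ∈ uIcc (0 : ℝ) (1 - 1 / (n + 2)) → DifferentiableAt ℝ (der η) s := by
    intro n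
    refine (absolutelyContinuousOnInterval_der hη ⟨le_rfl, one_pos⟩ ⟨?_, ?_⟩).ae_differentiableAt
    · rw [sub_nonneg, div_le_one (by positivity)]
      have : (0 : ℝ) ≤ n := by positivity
      linarith
    · have : (0 : ℝ) < 1 / (n + 2) := by positivity
      linarith
  filter_upwards [ae_all_iff.2 h] with s hs hs1
  obtain ⟨n, hn⟩ := exists_nat_one_div_lt (sub_pos.2 hs1.2)
  have hn2 : 1 / ((n : ℝ) + 2) ≤ 1 / (n + 1) := by
    apply one_div_le_one_div_of_le <;> [positivity; linarith]
  rw [der2_eq_deriv η hs1]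
  exact (hs n (by rw [mem_uIcc]; left; exact ⟨hs1.1.le, by linarith⟩)).hasDerivAt

/-- The derivative of `η - ξ` on `[0,1)`. -/
noncomputable def gapSlope (ξ η : ℝ → ℝ) (s : ℝ) : ℝ := der η s - deriv ξ s

theorem IsRegularMixture.contDiffOn_deriv (hξ : IsRegularMixture ξ) :
    ContDiffOn ℝ 3 (deriv ξ) (Ioo (-1) 1) :=
  hξ.contDiffOn.deriv_of_isOpen isOpen_Ioo (by norm_num)

theorem IsRegularMixture.contDiffOn_deriv2 (hξ : IsRegularMixture ξ) :
    ContDiffOn ℝ 2 (deriv (deriv ξ)) (Ioo (-1) 1) :=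
  hξ.contDiffOn_deriv.deriv_of_isOpen isOpen_Ioo (by norm_num)

theorem IsRegularMixture.hasDerivAt (hξ : IsRegularMixture ξ) (hs : s ∈ Ico (0 : ℝ) 1) :
    HasDerivAt ξ (deriv ξ s) s :=
  ((hξ.contDiffOn.differentiableOn (by norm_num)).differentiableAt
    (Ioo_mem_nhds (by linarith [hs.1]) hs.2)).hasDerivAt

theorem IsRegularMixture.hasDerivAt_deriv (hξ : IsRegularMixture ξ) (hs : s ∈ Ico (0 : ℝ) 1) :
    HasDerivAt (deriv ξ) (deriv (deriv ξ) s) s :=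
  ((hξ.contDiffOn_deriv.differentiableOn (by norm_num)).differentiableAt
    (Ioo_mem_nhds (by linarith [hs.1]) hs.2)).hasDerivAt

theorem IsRegularMixture.continuousOn_deriv2 (hξ : IsRegularMixture ξ) :
    ContinuousOn (deriv (deriv ξ)) (Ico 0 1) :=
  hξ.contDiffOn_deriv2.continuousOn.mono fun s hs => ⟨by linarith [hs.1], hs.2⟩

theorem hasDerivAt_gap (hξ : IsRegularMixture ξ) (hη : η ∈ spaceX) (hs : s ∈ Ioo (0 : ℝ) 1) :
    HasDerivAt (fun s => η s - ξ s) (gapSlope ξ η s) s :=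
  (hasDerivAt_der hη.1 hs).sub (hξ.hasDerivAt (Ioo_subset_Ico_self hs))

theorem continuousOn_gap (hξ : IsRegularMixture ξ) (hη : η ∈ spaceX) :
    ContinuousOn (fun s => η s - ξ s) (Ico 0 1) :=
  hη.1.continuousOn.sub fun _ hs => (hξ.hasDerivAt hs).continuousAt.continuousWithinAt

theorem absolutelyContinuousOnInterval_gapSlope (hξ : IsRegularMixture ξ) (hη : η ∈ spaceX)
    (hx : x ∈ Ico (0 : ℝ) 1) (hy : y ∈ Ico (0 : ℝ) 1) :
    AbsolutelyContinuousOnInterval (gapSlope ξ η) x y := by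
  refine (absolutelyContinuousOnInterval_der hη hx hy).fun_sub ?_
  refine ContDiffOn.absolutelyContinuousOnInterval
    ((hξ.contDiffOn_deriv.mono ?_).of_le (by norm_num))
  refine (ordConnected_Ico.uIcc_subset hx hy).trans
    fun _ hs => ⟨by linarith [hs.1], hs.2⟩

theorem ae_deriv_gapSlope (hξ : IsRegularMixture ξ) (hη : η ∈ spaceX) :
    ∀ᵐ s, s ∈ Ioo (0 : ℝ) 1 →
      HasDerivAt (gapSlope ξ η) (der2 η s - deriv (deriv ξ) s) s := by
  filter_upwards [ae_hasDerivAt_der hη] with s hs hs1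
  exact (hs hs1).sub (hξ.hasDerivAt_deriv (Ioo_subset_Ico_self hs1))

/-- Otherwise `η'' ≤ ξ''` almost everywhere on the interval, and the absolutely continuous slope
could not increase. The three lemmas that follow are variants; in the last two a weak change of
slope suffices, since a strict sign of the derivative would force a strict change. -/
theorem measure_lt_der2_ne_zero (hξ : IsRegularMixture ξ) (hη : η ∈ spaceX) (hx : 0 ≤ x)
    (hxy : x < y) (hy : y < 1) (hW : gapSlope ξ η x < gapSlope ξ η y) :
    volume ({s | deriv (deriv ξ) s < der2 η s} ∩ Ioo x y) ≠ 0 := by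
  intro h0
  have hF := (absolutelyContinuousOnInterval_gapSlope hξ hη (x := x) (y := y)
    ⟨hx, by linarith⟩ ⟨by linarith, hy⟩).neg
  have := hF.le_of_ae_deriv_nonneg hxy.le (by
    filter_upwards [ae_deriv_gapSlope hξ hη, measure_eq_zero_iff_ae_notMem.1 h0] with s hs hs0 hsI
    rw [(hs ⟨by linarith [hsI.1], by linarith [hsI.2]⟩).neg.deriv]
    by_contra hneg
    exact hs0 ⟨by rw [mem_ofPred_eq]; linarith, hsI⟩)
  simp only [Pi.neg_apply] at this
  linarith

theorem measure_der2_lt_ne_zero (hξ : IsRegularMixture ξ) (hη : η ∈ spaceX) (hx : 0 ≤ x)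
    (hxy : x < y) (hy : y < 1) (hW : gapSlope ξ η y < gapSlope ξ η x) :
    volume ({s | der2 η s < deriv (deriv ξ) s} ∩ Ioo x y) ≠ 0 := by
  intro h0
  have hF := absolutelyContinuousOnInterval_gapSlope hξ hη (x := x) (y := y)
    ⟨hx, by linarith⟩ ⟨by linarith, hy⟩
  have := hF.le_of_ae_deriv_nonneg hxy.le (by
    filter_upwards [ae_deriv_gapSlope hξ hη, measure_eq_zero_iff_ae_notMem.1 h0] with s hs hs0 hsI
    rw [(hs ⟨by linarith [hsI.1], by linarith [hsI.2]⟩).deriv]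
    by_contra hneg
    exact hs0 ⟨by rw [mem_ofPred_eq]; linarith, hsI⟩)
  linarith

theorem measure_le_der2_ne_zero (hξ : IsRegularMixture ξ) (hη : η ∈ spaceX) (hx : 0 ≤ x)
    (hxy : x < y) (hy : y < 1) (hW : gapSlope ξ η x ≤ gapSlope ξ η y) :
    volume ({s | deriv (deriv ξ) s ≤ der2 η s} ∩ Ioo x y) ≠ 0 := by
  intro h0
  have hF := (absolutelyContinuousOnInterval_gapSlope hξ hη (x := x) (y := y)
    ⟨hx, by linarith⟩ ⟨by linarith, hy⟩).neg
  have := hF.lt_of_ae_deriv_pos hxy (by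
    filter_upwards [ae_deriv_gapSlope hξ hη, measure_eq_zero_iff_ae_notMem.1 h0] with s hs hs0 hsI
    rw [(hs ⟨by linarith [hsI.1], by linarith [hsI.2]⟩).neg.deriv]
    by_contra hneg
    exact hs0 ⟨by rw [mem_ofPred_eq]; linarith, hsI⟩)
  simp only [Pi.neg_apply] at this
  linarith

theorem measure_der2_le_ne_zero (hξ : IsRegularMixture ξ) (hη : η ∈ spaceX) (hx : 0 ≤ x)
    (hxy : x < y) (hy : y < 1) (hW : gapSlope ξ η y ≤ gapSlope ξ η x) :
    volume ({s | der2 η s ≤ deriv (deriv ξ) s} ∩ Ioo x y) ≠ 0 := by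
  intro h0
  have hF := absolutelyContinuousOnInterval_gapSlope hξ hη (x := x) (y := y)
    ⟨hx, by linarith⟩ ⟨by linarith, hy⟩
  have := hF.lt_of_ae_deriv_pos hxy (by
    filter_upwards [ae_deriv_gapSlope hξ hη, measure_eq_zero_iff_ae_notMem.1 h0] with s hs hs0 hsI
    rw [(hs ⟨by linarith [hsI.1], by linarith [hsI.2]⟩).deriv]
    by_contra hneg
    exact hs0 ⟨by rw [mem_ofPred_eq]; linarith, hsI⟩)
  linarith

theorem gapSlope_eq_zero (hξ : IsRegularMixture ξ) {h : ℝ} (hη : η ∈ admissible ξ h)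
    (hs : s ∈ Ioo (0 : ℝ) 1) (heq : η s = ξ s) : gapSlope ξ η s = 0 := by
  refine IsLocalMin.hasDerivAt_eq_zero ?_ (hasDerivAt_gap hξ hη.1 hs)
  filter_upwards [Ioo_mem_nhds hs.1 hs.2] with t ht
  have := hη.2.1 t (Ioo_subset_Ico_self ht)
  simp only [heq, sub_self]
  linarith

/-- A coincidence at the endpoint `0` need not be a critical point. This one-sided bound is what
replaces `gapSlope_eq_zero` there. -/
theorem gapSlope_zero_nonpos (hξ : IsRegularMixture ξ) {h : ℝ} (hη : η ∈ admissible ξ h) :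
    gapSlope ξ η 0 ≤ 0 := by
  have := sq_nonneg h
  rw [gapSlope, hη.2.2.1, hξ.deriv_zero]
  linarith

end Derivatives

/-! ### Test functions orthogonal to affine functions -/

/-- A bounded measurable function supported in `(l, r)` and orthogonal to affine functions. -/
structure IsMomentFree (ψ : ℝ → ℝ) (l r : ℝ) : Prop where
  measurable : Measurable ψ
  bounded : ∃ B, ∀ s, |ψ s| ≤ B
  support : ∀ s, s ∉ Ioo l r → ψ s = 0
  integral_eq_zero : ∫ s, ψ s = 0
  moment_eq_zero : ∫ s, s * ψ s = 0

/-- A moment-free function which is non-positive on `[x, z]` and non-negative elsewhere: it tests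
convexity. -/
structure IsConvexityTest (ψ : ℝ → ℝ) (l x z r : ℝ) : Prop extends IsMomentFree ψ l r where
  nonpos : ∀ s ∈ Icc x z, ψ s ≤ 0
  nonneg : ∀ s ∉ Icc x z, 0 ≤ ψ s
  ne_zero : volume {s | 0 < ψ s} ≠ 0

namespace IsMomentFree

variable {ψ : ℝ → ℝ} {l r : ℝ}

theorem integrable (hψ : IsMomentFree ψ l r) : Integrable ψ := by
  obtain ⟨B, hB⟩ := hψ.bounded
  have : IntegrableOn ψ (Icc l r) :=
    Measure.integrableOn_of_bounded (M := B) (by simp) hψ.measurable.aestronglyMeasurable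
      (Filter.Eventually.of_forall fun s => by simpa using hB s)
  refine (integrableOn_iff_integrable_of_support_subset fun s hs => ?_).1 this
  by_contra hs'
  exact hs (hψ.support s fun h => hs' (Ioo_subset_Icc_self h))

theorem integrable_mul (hψ : IsMomentFree ψ l r) {k : ℝ → ℝ} (hk : ContinuousOn k (Icc l r)) :
    Integrable fun s => k s * ψ s := by
  refine (integrableOn_iff_integrable_of_support_subset (s := Icc l r) fun s hs => ?_).1 ?_
  · by_contra hs'
    refine hs ?_
    simp [hψ.support s fun h => hs' (Ioo_subset_Icc_self h)]
  · exact hψ.integrable.integrableOn.continuousOn_mul hk isCompact_Icc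

theorem neg (hψ : IsMomentFree ψ l r) : IsMomentFree (fun s => -ψ s) l r where
  measurable := hψ.measurable.neg
  bounded := by simpa using hψ.bounded
  support s hs := by simp [hψ.support s hs]
  integral_eq_zero := by rw [integral_neg, hψ.integral_eq_zero, neg_zero]
  moment_eq_zero := by simp_rw [mul_neg]; rw [integral_neg, hψ.moment_eq_zero, neg_zero]

theorem integral_affine_mul (hψ : IsMomentFree ψ l r) (p q : ℝ) :
    ∫ s, (p + q * s) * ψ s = 0 := by
  have h1 : ∀ s, (p + q * s) * ψ s = p * ψ s + q * (s * ψ s) := fun s => by ring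
  simp_rw [h1]
  rw [integral_add (hψ.integrable.const_mul p)
    ((hψ.integrable_mul (k := fun s => s) (by fun_prop)).const_mul q),
    integral_const_mul, integral_const_mul, hψ.integral_eq_zero, hψ.moment_eq_zero]
  simp

end IsMomentFree

/-! ### Convexity and chords -/

section Chord

variable {k : ℝ → ℝ} {S : Set ℝ} {x z t : ℝ}

/-- `(z - x)` times the difference of `k` and its chord through `x` and `z`. -/
def chordGap (k : ℝ → ℝ) (x z t : ℝ) : ℝ := (z - x) * (k t - k x) - (k z - k x) * (t - x)

theorem ConvexOn.chordGap_nonneg (hk : ConvexOn ℝ S k) (hx : x ∈ S) (hz : z ∈ S) (ht : t ∈ S)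
    (hxz : x < z) (h : t ∉ Icc x z) : 0 ≤ chordGap k x z t := by
  unfold chordGap
  rcases lt_or_ge t x with htx | htx
  · have := hk.slope_mono_adjacent ht hz htx hxz
    rw [div_le_div_iff₀ (by linarith) (by linarith)] at this
    linarith
  · have hzt : z < t := by
      by_contra! hcon
      exact h ⟨htx, hcon⟩
    have := hk.slope_mono_adjacent hx ht hxz hzt
    rw [div_le_div_iff₀ (by linarith) (by linarith)] at this
    linarith

theorem StrictConvexOn.chordGap_pos (hk : StrictConvexOn ℝ S k) (hx : x ∈ S) (hz : z ∈ S)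
    (ht : t ∈ S) (hxz : x < z) (h : t ∉ Icc x z) : 0 < chordGap k x z t := by
  unfold chordGap
  rcases lt_or_ge t x with htx | htx
  · have := hk.slope_strict_mono_adjacent ht hz htx hxz
    rw [div_lt_div_iff₀ (by linarith) (by linarith)] at this
    linarith
  · have hzt : z < t := by
      by_contra! hcon
      exact h ⟨htx, hcon⟩
    have := hk.slope_strict_mono_adjacent hx ht hxz hzt
    rw [div_lt_div_iff₀ (by linarith) (by linarith)] at this
    linarith

theorem ConvexOn.chordGap_nonpos (hk : ConvexOn ℝ S k) (hx : x ∈ S) (hz : z ∈ S)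
    (h : t ∈ Icc x z) : chordGap k x z t ≤ 0 := by
  unfold chordGap
  rcases h.1.eq_or_lt with rfl | htx
  · simp
  rcases h.2.eq_or_lt with rfl | htz
  · linarith
  have := hk.slope_mono_adjacent hx hz htx htz
  rw [div_le_div_iff₀ (by linarith) (by linarith)] at this
  linarith

end Chord

namespace IsConvexityTest

variable {ψ k : ℝ → ℝ} {S : Set ℝ} {l x z r : ℝ}

theorem integral_chordGap_mul (hψ : IsConvexityTest ψ l x z r) (hc : ContinuousOn k (Icc l r)) :
    ∫ t, chordGap k x z t * ψ t = (z - x) * ∫ t, k t * ψ t := by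
  have h1 : ∀ t, chordGap k x z t * ψ t =
      (z - x) * (k t * ψ t) + ((-(z - x) * k x + (k z - k x) * x) + -(k z - k x) * t) * ψ t :=
    fun t => by unfold chordGap; ring
  simp_rw [h1]
  rw [integral_add ((hψ.integrable_mul hc).const_mul _)
    (hψ.integrable_mul (by fun_prop)), integral_const_mul, hψ.integral_affine_mul, add_zero]

/-- The two factors have the same sign pattern: a convex function lies below its chord on `[x, z]`,
above the extended chord outside, and `ψ` changes sign at the same places. -/
theorem chordGap_mul_nonneg (hψ : IsConvexityTest ψ l x z r) (hk : ConvexOn ℝ S k)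
    (hx : x ∈ S) (hz : z ∈ S) (hxz : x < z) (hS : Ioo l r ⊆ S) (t : ℝ) :
    0 ≤ chordGap k x z t * ψ t := by
  by_cases h : t ∈ Icc x z
  · exact mul_nonneg_of_nonpos_of_nonpos (hk.chordGap_nonpos hx hz h) (hψ.nonpos t h)
  · by_cases ht : t ∈ Ioo l r
    · exact mul_nonneg (hk.chordGap_nonneg hx hz (hS ht) hxz h) (hψ.nonneg t h)
    · simp [hψ.support t ht]

theorem integral_mul_nonneg (hψ : IsConvexityTest ψ l x z r) (hk : ConvexOn ℝ S k)
    (hc : ContinuousOn k (Icc l r)) (hx : x ∈ S) (hz : z ∈ S) (hxz : x < z) (hS : Ioo l r ⊆ S) :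
    0 ≤ ∫ t, k t * ψ t := by
  have h := hψ.integral_chordGap_mul hc
  have h0 : 0 ≤ ∫ t, chordGap k x z t * ψ t :=
    integral_nonneg fun t => hψ.chordGap_mul_nonneg hk hx hz hxz hS t
  rw [h] at h0
  exact nonneg_of_mul_nonneg_right h0 (sub_pos.2 hxz)

theorem integral_mul_pos (hψ : IsConvexityTest ψ l x z r) (hk : StrictConvexOn ℝ S k)
    (hc : ContinuousOn k (Icc l r)) (hx : x ∈ S) (hz : z ∈ S) (hxz : x < z) (hS : Ioo l r ⊆ S) :
    0 < ∫ t, k t * ψ t := by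
  have h := hψ.integral_chordGap_mul hc
  have hi : Integrable fun t => chordGap k x z t * ψ t := by
    refine hψ.integrable_mul ?_
    unfold chordGap
    fun_prop
  have h0 : 0 < ∫ t, chordGap k x z t * ψ t := by
    rw [integral_pos_iff_support_of_nonneg
      (fun t => hψ.chordGap_mul_nonneg hk.convexOn hx hz hxz hS t) hi]
    refine pos_iff_ne_zero.2 fun hz0 => hψ.ne_zero (measure_mono_null (fun t ht => ?_) hz0)
    have ht0 : 0 < ψ t := ht
    have h1 : t ∉ Icc x z := fun h => absurd (hψ.nonpos t h) (not_le.2 ht0)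
    have h2 : t ∈ Ioo l r := by
      by_contra hcon
      exact ht0.ne' (hψ.support t hcon)
    exact (mul_pos (hk.chordGap_pos hx hz (hS h2) hxz h1) ht0).ne'
  rw [h] at h0
  exact pos_of_mul_pos_right h0 (sub_pos.2 hxz).le

end IsConvexityTest

/-! ### Construction of convexity tests -/

theorem setIntegral_pos_of_pos {g : ℝ → ℝ} {A : Set ℝ} (hA : MeasurableSet A)
    (hA0 : volume A ≠ 0) (hg : IntegrableOn g A) (hpos : ∀ s ∈ A, 0 < g s) :
    0 < ∫ s in A, g s := by
  rw [setIntegral_pos_iff_support_of_nonneg_ae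
    ((ae_restrict_iff' hA).2 (Filter.Eventually.of_forall fun s hs => (hpos s hs).le)) hg]
  refine pos_iff_ne_zero.2 fun h0 => hA0 (measure_mono_null (fun s hs => ?_) h0)
  exact ⟨(hpos s hs).ne', hs⟩

/-- Three sets of positive measure, lying in `(l, x)`, `(x, z)` and `(z, r)`, carry a function that
tests convexity. -/
theorem exists_isConvexityTest {l x z r : ℝ} (hxz : x < z) {A K C : Set ℝ}
    (hA : MeasurableSet A) (hK : MeasurableSet K) (hC : MeasurableSet C)
    (hA0 : volume A ≠ 0) (hK0 : volume K ≠ 0) (hC0 : volume C ≠ 0)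
    (hAs : A ⊆ Ioo l x) (hKs : K ⊆ Ioo x z) (hCs : C ⊆ Ioo z r) :
    ∃ ψ, IsConvexityTest ψ l x z r ∧ (∀ s, 0 < ψ s → s ∈ A ∪ C) ∧ (∀ s, ψ s < 0 ↔ s ∈ K) := by
  have hiI : ∀ {p q : ℝ} {T : Set ℝ} {g : ℝ → ℝ}, Continuous g → T ⊆ Ioo p q → IntegrableOn g T :=
    fun {p q T g} hg hT =>
      (hg.continuousOn.integrableOn_compact (isCompact_Icc (a := p) (b := q))).mono_set
        (hT.trans Ioo_subset_Icc_self)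
  have hpos : ∀ {p q : ℝ} {T : Set ℝ}, MeasurableSet T → volume T ≠ 0 → T ⊆ Ioo p q →
      p * (∫ _ in T, (1 : ℝ)) < ∫ s in T, s ∧ ∫ s in T, s < q * ∫ _ in T, (1 : ℝ) := by
    intro p q T hT hT0 hTs
    have i1 : IntegrableOn (fun _ => (1 : ℝ)) T := hiI continuous_const hTs
    have i2 : IntegrableOn (fun s => s) T := hiI continuous_id hTs
    have h1 := setIntegral_pos_of_pos (g := fun s => s - p * 1) hT hT0 (i2.sub (i1.const_mul p))
      fun s hs => by linarith [(hTs hs).1]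
    have h2 := setIntegral_pos_of_pos (g := fun s => q * 1 - s) hT hT0 ((i1.const_mul q).sub i2)
      fun s hs => by linarith [(hTs hs).2]
    rw [integral_sub i2 (i1.const_mul p), integral_const_mul] at h1
    rw [integral_sub (i1.const_mul q) i2, integral_const_mul] at h2
    constructor <;> linarith
  have hmpos : ∀ {p q : ℝ} {T : Set ℝ}, MeasurableSet T → volume T ≠ 0 → T ⊆ Ioo p q →
      0 < ∫ _ in T, (1 : ℝ) := fun hT hT0 hTs =>
    setIntegral_pos_of_pos hT hT0 (hiI continuous_const hTs) fun _ _ => one_pos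
  have hApos := hmpos hA hA0 hAs
  have hKpos := hmpos hK hK0 hKs
  have hCpos := hmpos hC hC0 hCs
  obtain ⟨-, hA2⟩ := hpos hA hA0 hAs
  obtain ⟨hK1, hK2⟩ := hpos hK hK0 hKs
  obtain ⟨hC1, -⟩ := hpos hC hC0 hCs
  set mA := ∫ _ in A, (1 : ℝ) with hmA
  set mK := ∫ _ in K, (1 : ℝ) with hmK
  set mC := ∫ _ in C, (1 : ℝ) with hmC
  set bA := ∫ s in A, s with hbA
  set bK := ∫ s in K, s with hbK
  set bC := ∫ s in C, s with hbC
  -- The weights are the cross product of the vectors of masses and first moments, so both moment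
  -- conditions hold identically. They are positive because the barycentres of `A`, `K`, `C` are
  -- strictly ordered, separated by `x` and `z`.
  have hcA : 0 < mK * bC - bK * mC := by
    nlinarith [mul_lt_mul_of_pos_left hC1 hKpos, mul_lt_mul_of_pos_right hK2 hCpos]
  have hcC : 0 < bK * mA - bA * mK := by
    nlinarith [mul_lt_mul_of_pos_right hK1 hApos, mul_lt_mul_of_pos_right hA2 hKpos]
  have hcK : 0 < bC * mA - bA * mC := by
    nlinarith [mul_lt_mul_of_pos_right hC1 hApos, mul_lt_mul_of_pos_right hA2 hCpos,
      mul_lt_mul_of_pos_right hxz (mul_pos hApos hCpos)]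
  set cA := mK * bC - bK * mC with hcA'
  set cC := bK * mA - bA * mK with hcC'
  set cK := bC * mA - bA * mC with hcK'
  set ψ : ℝ → ℝ := fun s =>
    A.indicator (fun _ => cA) s + C.indicator (fun _ => cC) s - K.indicator (fun _ => cK) s
    with hψdef
  have hvA : ∀ s ∈ A, ψ s = cA := by
    intro s hs
    have h1 : s ∉ C := fun h => by linarith [(hAs hs).2, (hCs h).1]
    have h2 : s ∉ K := fun h => by linarith [(hAs hs).2, (hKs h).1]
    simp [hψdef, hs, h1, h2]
  have hvC : ∀ s ∈ C, ψ s = cC := by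
    intro s hs
    have h1 : s ∉ A := fun h => by linarith [(hAs h).2, (hCs hs).1]
    have h2 : s ∉ K := fun h => by linarith [(hCs hs).1, (hKs h).2]
    simp [hψdef, hs, h1, h2]
  have hvK : ∀ s ∈ K, ψ s = -cK := by
    intro s hs
    have h1 : s ∉ A := fun h => by linarith [(hAs h).2, (hKs hs).1]
    have h2 : s ∉ C := fun h => by linarith [(hCs h).1, (hKs hs).2]
    simp [hψdef, hs, h1, h2]
  have hv0 : ∀ s, s ∉ A → s ∉ C → s ∉ K → ψ s = 0 := by
    intro s h1 h2 h3
    simp [hψdef, h1, h2, h3]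
  have hxK : ∀ s ∈ K, s ∈ Icc x z := fun s hs => Ioo_subset_Icc_self (hKs hs)
  have hxA : ∀ s ∈ A, s ∉ Icc x z := fun s hs h => by linarith [(hAs hs).2, h.1]
  have hxC : ∀ s ∈ C, s ∉ Icc x z := fun s hs h => by linarith [(hCs hs).1, h.2]
  have hlx : l < x := by
    obtain ⟨s, hs⟩ := nonempty_of_measure_ne_zero hA0
    exact (hAs hs).1.trans (hAs hs).2
  have hzr : z < r := by
    obtain ⟨s, hs⟩ := nonempty_of_measure_ne_zero hC0
    exact (hCs hs).1.trans (hCs hs).2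
  have hint : ∀ g : ℝ → ℝ, Continuous g →
      ∫ s, g s * ψ s = cA * (∫ s in A, g s) + cC * (∫ s in C, g s) - cK * ∫ s in K, g s := by
    intro g hg
    have h1 : ∀ s, g s * ψ s = A.indicator (fun s => cA * g s) s +
        C.indicator (fun s => cC * g s) s - K.indicator (fun s => cK * g s) s := by
      intro s
      classical
      simp only [hψdef, indicator_apply]
      split_ifs <;> ring
    have iA := (IntegrableOn.integrable_indicator ((hiI hg hAs).const_mul cA) hA)
    have iC := (IntegrableOn.integrable_indicator ((hiI hg hCs).const_mul cC) hC)
    have iK := (IntegrableOn.integrable_indicator ((hiI hg hKs).const_mul cK) hK)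
    simp_rw [h1]
    have iAC : Integrable fun s =>
        A.indicator (fun s => cA * g s) s + C.indicator (fun s => cC * g s) s := iA.add iC
    rw [integral_sub iAC iK, integral_add iA iC, integral_indicator hA,
      integral_indicator hC, integral_indicator hK, integral_const_mul, integral_const_mul,
      integral_const_mul]
  refine ⟨ψ, ⟨⟨?_, ⟨cA + cC + cK, fun s => ?_⟩, fun s hs => ?_, ?_, ?_⟩, fun s hs => ?_,
    fun s hs => ?_, ?_⟩, fun s hs => ?_, fun s => ⟨fun hs => ?_, fun hs => ?_⟩⟩
  · exact ((measurable_const.indicator hA).add (measurable_const.indicator hC)).sub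
      (measurable_const.indicator hK)
  · by_cases h1 : s ∈ A
    · rw [hvA s h1, abs_of_pos hcA]; linarith
    by_cases h2 : s ∈ C
    · rw [hvC s h2, abs_of_pos hcC]; linarith
    by_cases h3 : s ∈ K
    · rw [hvK s h3, abs_neg, abs_of_pos hcK]; linarith
    rw [hv0 s h1 h2 h3, abs_zero]
    positivity
  · refine hv0 s (fun h => hs ⟨(hAs h).1, ?_⟩) (fun h => hs ⟨?_, (hCs h).2⟩)
      fun h => hs ⟨?_, ?_⟩
    · linarith [(hAs h).2]
    · linarith [(hCs h).1]
    · linarith [(hKs h).1]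
    · linarith [(hKs h).2]
  · have := hint (fun _ => 1) continuous_const
    simp only [one_mul] at this
    rw [this, ← hmA, ← hmC, ← hmK, hcA', hcC', hcK']
    ring
  · rw [hint (fun s => s) continuous_id, ← hbA, ← hbC, ← hbK, hcA', hcC', hcK']
    ring
  · by_cases h3 : s ∈ K
    · rw [hvK s h3]; linarith
    · exact (hv0 s (fun h => hxA s h hs) (fun h => hxC s h hs) h3).le
  · by_cases h1 : s ∈ A
    · rw [hvA s h1]; exact hcA.le
    by_cases h2 : s ∈ C
    · rw [hvC s h2]; exact hcC.le
    exact (hv0 s h1 h2 fun h => hs (hxK s h)).ge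
  · refine fun h0 => hA0 (measure_mono_null (fun s hs => ?_) h0)
    rw [mem_ofPred_eq, hvA s hs]
    exact hcA
  · by_contra hcon
    rw [mem_union, not_or] at hcon
    by_cases h3 : s ∈ K
    · rw [hvK s h3] at hs
      linarith
    · rw [hv0 s hcon.1 hcon.2 h3] at hs
      exact lt_irrefl _ hs
  · by_contra h3
    by_cases h1 : s ∈ A
    · rw [hvA s h1] at hs; linarith
    by_cases h2 : s ∈ C
    · rw [hvC s h2] at hs; linarith
    rw [hv0 s h1 h2 h3] at hs
    exact lt_irrefl _ hs
  · rw [hvK s hs]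
    linarith

/-! ### The variation `φ` with `φ'' = ψ` -/

section Primitive

/-- The second primitive of `ψ` that vanishes to first order at `0`. -/
noncomputable def secondPrimitive (ψ : ℝ → ℝ) (s : ℝ) : ℝ := ∫ t in 0..s, ∫ τ in 0..t, ψ τ

variable {ψ : ℝ → ℝ} {l r s : ℝ}

theorem IsMomentFree.continuous_primitive (hψ : IsMomentFree ψ l r) :
    Continuous fun t => ∫ τ in 0..t, ψ τ :=
  intervalIntegral.continuous_primitive (fun _ _ => hψ.integrable.intervalIntegrable) 0

theorem IsMomentFree.hasDerivAt_secondPrimitive (hψ : IsMomentFree ψ l r) (s : ℝ) :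
    HasDerivAt (secondPrimitive ψ) (∫ τ in 0..s, ψ τ) s :=
  intervalIntegral.integral_hasDerivAt_right (hψ.continuous_primitive.intervalIntegrable _ _)
    hψ.continuous_primitive.stronglyMeasurable.stronglyMeasurableAtFilter
    hψ.continuous_primitive.continuousAt

theorem IsMomentFree.ae_hasDerivAt_primitive (hψ : IsMomentFree ψ l r) :
    ∀ᵐ s, HasDerivAt (fun t => ∫ τ in 0..t, ψ τ) (ψ s) s :=
  (LocallyIntegrable.ae_hasDerivAt_integral hψ.integrable.locallyIntegrable).mono
    fun _ hs => hs 0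

/-- Integration by parts against `t - s`. Since `0 ≤ l`, nothing is lost to the left of `0`. The
kernel is convex in `t`, which later gives the sign, and affine on the support once `s ≥ r`. -/
theorem IsMomentFree.secondPrimitive_eq (hψ : IsMomentFree ψ l r) (hl : 0 ≤ l) (hs : 0 ≤ s) :
    secondPrimitive ψ s = ∫ t, max (s - t) 0 * ψ t := by
  have hac : AbsolutelyContinuousOnInterval (fun t => ∫ τ in 0..t, ψ τ) 0 s :=
    hψ.integrable.intervalIntegrable.absolutelyContinuousOnInterval_intervalIntegral (by simp)
  have hac2 : AbsolutelyContinuousOnInterval (fun t => t - s) 0 s :=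
    ContDiffOn.absolutelyContinuousOnInterval (by fun_prop)
  have h := hac.integral_mul_deriv_eq_deriv_mul hac2
  have h1 : ∀ t, deriv (fun t => t - s) t = 1 := fun t => by simp
  simp only [h1, mul_one, sub_self, mul_zero, intervalIntegral.integral_same, zero_mul,
    zero_sub] at h
  rw [secondPrimitive, h, ← intervalIntegral.integral_neg, intervalIntegral.integral_of_le hs,
    ← integral_indicator measurableSet_Ioc]
  refine integral_congr_ae ?_
  filter_upwards [hψ.ae_hasDerivAt_primitive] with t ht
  by_cases htI : t ∈ Ioc 0 s
  · rw [indicator_of_mem htI, ht.deriv, max_eq_left (by linarith [htI.2])]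
    ring
  · rw [indicator_of_notMem htI]
    rcases le_or_gt t 0 with h0 | h0
    · rw [hψ.support t fun h => by linarith [h.1], mul_zero]
    · have : s < t := by
        by_contra! hcon
        exact htI ⟨h0, hcon⟩
      rw [max_eq_right (by linarith), zero_mul]

theorem IsMomentFree.secondPrimitive_eq_zero (hψ : IsMomentFree ψ l r) (hl : 0 ≤ l) (hs : 0 ≤ s)
    (h : s ∉ Ioo l r) : secondPrimitive ψ s = 0 := by
  rw [hψ.secondPrimitive_eq hl hs]
  rcases le_or_gt s l with hsl | hsl
  · refine integral_eq_zero_of_ae (Filter.Eventually.of_forall fun t => ?_)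
    by_cases ht : t ∈ Ioo l r
    · simp [max_eq_right (show s - t ≤ 0 by linarith [ht.1])]
    · simp [hψ.support t ht]
  · have hrs : r ≤ s := by
      by_contra! hcon
      exact h ⟨hsl, hcon⟩
    refine Eq.trans (integral_congr_ae (Filter.Eventually.of_forall fun t => ?_))
      (hψ.integral_affine_mul s (-1))
    by_cases ht : t ∈ Ioo l r
    · simp only [max_eq_left (show 0 ≤ s - t by linarith [ht.2])]
      ring
    · simp [hψ.support t ht]

theorem IsConvexityTest.secondPrimitive_nonneg {x z : ℝ} (hψ : IsConvexityTest ψ l x z r)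
    (hxz : x < z) (hl : 0 ≤ l) (hs : 0 ≤ s) : 0 ≤ secondPrimitive ψ s := by
  rw [hψ.secondPrimitive_eq hl hs]
  refine hψ.integral_mul_nonneg (S := univ) (k := fun t => max (s - t) 0) ?_ (by fun_prop)
    (mem_univ _) (mem_univ _) hxz (subset_univ _)
  refine ConvexOn.sup ⟨convex_univ, ?_⟩ (convexOn_const 0 convex_univ)
  intro p _ q _ a b _ _ hab
  simp only [smul_eq_mul]
  nlinarith

end Primitive

/-! ### Increments of the square root -/

section SqrtIncrement

variable {u v δ θ : ℝ}

theorem sqrt_sub_sqrt_le_of_le (hu : 0 ≤ u) (huv : u ≤ v) (hδ : 0 ≤ δ) :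
    √(v + δ) - √v ≤ √(u + δ) - √u := by
  have hv : 0 ≤ v := hu.trans huv
  have h1 := Real.sqrt_le_sqrt huv
  have h2 : √(u + δ) ≤ √(v + δ) := Real.sqrt_le_sqrt (by linarith)
  have h3 : √u ≤ √(u + δ) := Real.sqrt_le_sqrt (by linarith)
  have h4 : √v ≤ √(v + δ) := Real.sqrt_le_sqrt (by linarith)
  have e1 := Real.sq_sqrt hu
  have e2 := Real.sq_sqrt hv
  have e3 := Real.sq_sqrt (show 0 ≤ u + δ by linarith)
  have e4 := Real.sq_sqrt (show 0 ≤ v + δ by linarith)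
  by_contra! hlt
  have h5 := Real.sqrt_nonneg u
  nlinarith [mul_le_mul_of_nonneg_left (add_le_add h1 h2) (sub_nonneg.2 h3)]

theorem le_sqrt_add_sub_sqrt (hθ : 0 < θ) (hθv : θ ≤ v) (hδ : -v ≤ δ) :
    δ / (2 * √v) - δ ^ 2 / (2 * (θ * √θ)) ≤ √(v + δ) - √v := by
  have hv : 0 < v := hθ.trans_le hθv
  have hsv : 0 < √v := Real.sqrt_pos.2 hv
  have hsθ : 0 < √θ := Real.sqrt_pos.2 hθ
  obtain ⟨x, rfl⟩ : ∃ x, δ = v * x := ⟨δ / v, by field_simp⟩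
  have hx : -1 ≤ x := by
    by_contra! hcon
    nlinarith
  -- When the left side is positive, squaring leaves the difference `x ^ 2 (1 + x) (3 - x) / 4`,
  -- which is non-negative for `-1 ≤ x < 2`.
  have h1 : 1 + x / 2 - x ^ 2 / 2 ≤ √(1 + x) := by
    rcases le_or_gt (1 + x / 2 - x ^ 2 / 2) 0 with h | h
    · exact h.trans (Real.sqrt_nonneg _)
    · apply Real.le_sqrt_of_sq_le
      have hx2 : x < 2 := by nlinarith
      nlinarith [mul_nonneg (mul_nonneg (show 0 ≤ 1 + x by linarith) (sq_nonneg x))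
        (show 0 ≤ 3 - x by linarith)]
  have h2 : √(v + v * x) = √v * √(1 + x) := by
    rw [← Real.sqrt_mul hv.le]
    ring_nf
  have h3 : v * x / (2 * √v) = √v * (x / 2) := by
    rw [div_eq_iff (by positivity)]
    nth_rewrite 1 [← Real.mul_self_sqrt hv.le]
    ring
  have h4 : √v * (x ^ 2 / 2) ≤ (v * x) ^ 2 / (2 * (θ * √θ)) := by
    rw [le_div_iff₀ (by positivity)]
    have : θ * √θ ≤ v * √v := by gcongr
    calc √v * (x ^ 2 / 2) * (2 * (θ * √θ)) = √v * x ^ 2 * (θ * √θ) := by ring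
      _ ≤ √v * x ^ 2 * (v * √v) := by gcongr
      _ = (√v * √v) * v * x ^ 2 := by ring
      _ = _ := by rw [Real.mul_self_sqrt hv.le]; ring
  rw [h2, h3]
  nlinarith

/-- Only `v` is bounded below, so the expansion is made at `v`. Concavity transfers it to `u`:
upward steps gain more from a smaller base, downward steps lose less from a larger one. -/
theorem le_sqrt_add_sub_sqrt_of_comparison (hθ : 0 < θ) (hθv : θ ≤ v) (hδ : -θ ≤ δ) (hu : 0 ≤ u)
    (hpos : 0 < δ → u ≤ v) (hneg : δ < 0 → v ≤ u) :
    δ / (2 * √v) - δ ^ 2 / (2 * (θ * √θ)) ≤ √(u + δ) - √u := by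
  refine (le_sqrt_add_sub_sqrt hθ hθv (by linarith)).trans ?_
  rcases lt_trichotomy δ 0 with h | rfl | h
  · have := sqrt_sub_sqrt_le_of_le (u := v + δ) (v := u + δ) (δ := -δ) (by linarith)
      (by linarith [hneg h]) (by linarith)
    simp only [add_neg_cancel_right] at this
    linarith
  · simp
  · exact sqrt_sub_sqrt_le_of_le hu (hpos h) h.le

theorem sqrt_add_le_add_sqrt (hu : 0 ≤ u) (hv : 0 ≤ v) : √(u + v) ≤ √u + √v := by
  refine Real.sqrt_le_iff.2 ⟨by positivity, ?_⟩
  nlinarith [Real.sq_sqrt hu, Real.sq_sqrt hv, mul_nonneg (Real.sqrt_nonneg u) (Real.sqrt_nonneg v)]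

theorem abs_sqrt_add_sub_sqrt_le (hu : 0 ≤ u) (huδ : 0 ≤ u + δ) : |√(u + δ) - √u| ≤ √|δ| := by
  have h1 : √(u + δ) ≤ √u + √|δ| :=
    (Real.sqrt_le_sqrt (add_le_add_right (le_abs_self δ) u)).trans
      (sqrt_add_le_add_sqrt hu (abs_nonneg δ))
  have h2 : √u ≤ √(u + δ) + √|δ| :=
    (Real.sqrt_le_sqrt (by linarith [neg_abs_le δ])).trans
      (sqrt_add_le_add_sqrt huδ (abs_nonneg δ))
  rw [abs_le]
  constructor <;> linarith

end SqrtIncrement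

/-! ### Finiteness of the dual functional at an optimum -/

section DualFunctional

variable {ξ η ψ v : ℝ → ℝ} {h s l r θ ε : ℝ}

/-- Completing the square in `√η''`. Equality holds exactly for `η'' = (1 - s)⁻²`, which dictates
the choice of `logBarrier`. -/
theorem dualIntegrand_nonpos (hs : s < 1) (hu : 0 ≤ der2 η s) : dualIntegrand η s ≤ 0 := by
  unfold dualIntegrand
  have h1 : 0 < 1 - s := by linarith
  set a := √(der2 η s) with ha
  have h2 : der2 η s = a ^ 2 := (Real.sq_sqrt hu).symm
  rw [h2]
  have : 2 * a - a ^ 2 * (1 - s) - 1 / (1 - s) = -((a * (1 - s) - 1) ^ 2 / (1 - s)) := by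
    field_simp
    ring
  rw [this]
  have := div_nonneg (sq_nonneg (a * (1 - s) - 1)) h1.le
  linarith

theorem ae_restrict_Ico_of_ae {p : ℝ → Prop} (hp : ∀ᵐ s, s ∈ Ioo (0 : ℝ) 1 → p s) :
    ∀ᵐ s ∂volume.restrict (Ico (0 : ℝ) 1), p s := by
  rw [restrict_Ico_eq_restrict_Ioc, ← restrict_Ioo_eq_restrict_Ioc]
  exact (ae_restrict_iff' measurableSet_Ioo).2 hp

theorem aemeasurable_der2 (η : ℝ → ℝ) :
    AEMeasurable (der2 η) (volume.restrict (Ico (0 : ℝ) 1)) := by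
  refine (measurable_deriv (der η)).aemeasurable.congr ?_
  refine ae_restrict_Ico_of_ae (Filter.Eventually.of_forall fun s hs => ?_)
  exact (der2_eq_deriv η hs).symm

theorem aemeasurable_dualIntegrand (η : ℝ → ℝ) :
    AEMeasurable (dualIntegrand η) (volume.restrict (Ico (0 : ℝ) 1)) := by
  have := aemeasurable_der2 η
  unfold dualIntegrand
  fun_prop

theorem der_eq_of_hasDerivWithinAt {d : ℝ} (hd : HasDerivWithinAt η d (Ico 0 1) s)
    (hs : s ∈ Ico (0 : ℝ) 1) : der η s = d :=
  hd.derivWithin (uniqueDiffOn_Ico 0 1 s hs)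

/-- The admissible functions `-log (1 - s) - s - h² s + M` at which the dual integrand vanishes. -/
noncomputable def logBarrier (h M s : ℝ) : ℝ := -Real.log (1 - s) - s - h ^ 2 * s + M

theorem der_logBarrier (h M : ℝ) (hs : s ∈ Ico (0 : ℝ) 1) :
    der (logBarrier h M) s = (1 - s)⁻¹ - 1 - h ^ 2 := by
  refine der_eq_of_hasDerivWithinAt (HasDerivAt.hasDerivWithinAt ?_) hs
  have h1 : HasDerivAt (fun s : ℝ => 1 - s) (-1) s := by
    simpa using (hasDerivAt_id s).const_sub 1
  have h2 := ((((h1.log (by linarith [hs.2])).neg.sub (hasDerivAt_id s)).sub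
    ((hasDerivAt_id s).const_mul (h ^ 2))).add_const M)
  convert! h2 using 1
  rw [neg_div, neg_neg, one_div, mul_one]

theorem der2_logBarrier (h M : ℝ) (hs : s ∈ Ico (0 : ℝ) 1) :
    der2 (logBarrier h M) s = ((1 - s) ^ 2)⁻¹ := by
  have h1 : HasDerivAt (fun s : ℝ => 1 - s) (-1) s := by
    simpa using (hasDerivAt_id s).const_sub 1
  have h2 := ((h1.fun_inv (by linarith [hs.2])).sub_const 1).sub_const (h ^ 2)
  refine der_eq_of_hasDerivWithinAt ?_ hs
  refine (h2.hasDerivWithinAt (s := Ico 0 1)).congr_of_mem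
    (fun t ht => der_logBarrier h M ht) hs |>.congr_deriv ?_
  rw [neg_neg, one_div]

theorem logBarrier_mem_admissible {M : ℝ} (hM : ∀ t ∈ Ico (0 : ℝ) 1, ξ t ≤ M) :
    logBarrier h (M + h ^ 2) ∈ admissible ξ h := by
  have hne : ∀ s ∈ Ico (0 : ℝ) 1, 1 - s ≠ 0 := fun s hs => by linarith [hs.2]
  refine ⟨⟨?_, ?_⟩, ?_, ?_, ?_⟩
  · unfold logBarrier
    exact (((((contDiffOn_const.sub contDiffOn_id).log hne).neg.sub contDiffOn_id).sub
      (contDiffOn_const.mul contDiffOn_id)).add contDiffOn_const)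
  · have hC : ContDiffOn ℝ 1 (fun s : ℝ => (1 - s)⁻¹ - 1 - h ^ 2) (Ico 0 1) :=
      ((contDiffOn_const.sub contDiffOn_id).inv hne).sub contDiffOn_const |>.sub contDiffOn_const
    have hL := hC.locallyLipschitzOn (convex_Ico 0 1)
    intro s hs
    obtain ⟨K, t, ht, hK⟩ := hL hs
    refine ⟨K, t ∩ Ico 0 1, Filter.inter_mem ht self_mem_nhdsWithin, ?_⟩
    intro a ha b hb
    rw [der_logBarrier _ _ ha.2, der_logBarrier _ _ hb.2]
    exact hK ha.1 hb.1
  · intro s hs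
    have h1 := Real.log_le_sub_one_of_pos (show 0 < 1 - s by linarith [hs.2])
    have h2 : h ^ 2 * s ≤ h ^ 2 := mul_le_of_le_one_right (sq_nonneg h) hs.2.le
    have := hM s hs
    unfold logBarrier
    linarith
  · rw [der_logBarrier _ _ (by norm_num)]
    norm_num
  · refine ae_restrict_Ico_of_ae (Filter.Eventually.of_forall fun s hs => ?_)
    rw [der2_logBarrier _ _ (Ioo_subset_Ico_self hs)]
    positivity

theorem dualIntegrand_logBarrier (h M : ℝ) (hs : s ∈ Ico (0 : ℝ) 1) :
    dualIntegrand (logBarrier h M) s = 0 := by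
  have h1 : 0 < 1 - s := by linarith [hs.2]
  rw [dualIntegrand, der2_logBarrier h M hs, Real.sqrt_inv, Real.sqrt_sq h1.le]
  field_simp
  ring

/-- If the integral were infinite, the logarithmic barrier, whose dual value is finite, would do
better. -/
theorem IsDualOptimal.lintegral_ne_top (hη : IsDualOptimal ξ h η)
    (hξ : IsRegularMixture ξ) :
    ∫⁻ s in Ico (0 : ℝ) 1, ENNReal.ofReal (-dualIntegrand η s) ≠ ∞ := by
  obtain ⟨M, hM⟩ := hξ.bounded
  have hle := hη.2 _ (logBarrier_mem_admissible (h := h) hM)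
  intro htop
  have h0 : ∫⁻ s in Ico (0 : ℝ) 1,
      ENNReal.ofReal (-dualIntegrand (logBarrier h (M + h ^ 2)) s) = 0 := by
    rw [setLIntegral_congr_fun measurableSet_Ico (g := fun _ => 0)]
    · simp
    · intro s hs
      simp [dualIntegrand_logBarrier _ _ hs]
  unfold dualFunctional at hle
  rw [htop, h0] at hle
  simp only [EReal.coe_ennreal_top, EReal.neg_top, EReal.bot_add, EReal.coe_ennreal_zero,
    neg_zero, zero_add] at hle
  rw [EReal.coe_mul_bot_of_pos (by norm_num), ← EReal.coe_mul, le_bot_iff] at hle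
  exact EReal.coe_ne_bot _ hle

/-- A variation of an optimal function that leaves its value at `0` unchanged does not increase the
integral of the dual integrand. -/
theorem IsDualOptimal.integral_increment_nonpos (hη : IsDualOptimal ξ h η)
    (hξ : IsRegularMixture ξ) {ζ Δ : ℝ → ℝ} (hζ : ζ ∈ admissible ξ h) (h0 : ζ 0 = η 0)
    (hΔ : IntegrableOn Δ (Ico 0 1))
    (heq : ∀ᵐ s ∂volume.restrict (Ico (0 : ℝ) 1),
      dualIntegrand ζ s = dualIntegrand η s + Δ s) :
    ∫ s in Ico (0 : ℝ) 1, Δ s ≤ 0 := by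
  have hfin := hη.lintegral_ne_top hξ
  have hnn : ∀ {ζ : ℝ → ℝ}, ζ ∈ admissible ξ h →
      ∀ᵐ s ∂volume.restrict (Ico (0 : ℝ) 1), 0 ≤ -dualIntegrand ζ s := by
    intro ζ hζ
    filter_upwards [hζ.2.2.2, ae_restrict_mem measurableSet_Ico] with s hs hs1
    linarith [dualIntegrand_nonpos hs1.2 hs]
  have hint : IntegrableOn (fun s => -dualIntegrand η s) (Ico 0 1) := by
    refine ⟨(aemeasurable_dualIntegrand η).neg.aestronglyMeasurable, ?_⟩
    rw [hasFiniteIntegral_iff_ofReal (hnn hη.1)]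
    exact hfin.lt_top
  have hint2 : IntegrableOn (fun s => -dualIntegrand ζ s) (Ico 0 1) := by
    refine (hint.sub hΔ).congr ?_
    filter_upwards [heq] with s hs
    simp only [Pi.sub_apply, hs]
    ring
  have hval : ∫ s in Ico (0 : ℝ) 1, -dualIntegrand ζ s =
      (∫ s in Ico (0 : ℝ) 1, -dualIntegrand η s) - ∫ s in Ico (0 : ℝ) 1, Δ s := by
    rw [← integral_sub hint hΔ]
    refine integral_congr_ae ?_
    filter_upwards [heq] with s hs
    rw [hs]
    ring
  have hle := hη.2 ζ hζ
  unfold dualFunctional at hle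
  rw [h0, ← ofReal_integral_eq_lintegral_ofReal hint (hnn hη.1),
    ← ofReal_integral_eq_lintegral_ofReal hint2 (hnn hζ), EReal.coe_ennreal_ofReal,
    EReal.coe_ennreal_ofReal, max_eq_left (integral_nonneg_of_ae (hnn hη.1)),
    max_eq_left (integral_nonneg_of_ae (hnn hζ)), hval] at hle
  norm_cast at hle
  linarith

end DualFunctional

/-! ### The first-order condition -/

section Variation

variable {ξ η ψ v : ℝ → ℝ} {h s l r θ ε : ℝ}

theorem der_add_secondPrimitive (hη : ContDiffOn ℝ 1 η (Ico 0 1)) (hψ : IsMomentFree ψ l r)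
    (ε : ℝ) (hs : s ∈ Ico (0 : ℝ) 1) :
    der (fun s => η s + ε * secondPrimitive ψ s) s = der η s + ε * ∫ τ in 0..s, ψ τ :=
  der_eq_of_hasDerivWithinAt ((hasDerivWithinAt_der hη hs).add
    ((hψ.hasDerivAt_secondPrimitive s).hasDerivWithinAt.const_mul ε)) hs

theorem ae_der2_add_secondPrimitive (hη : η ∈ spaceX) (hψ : IsMomentFree ψ l r) (ε : ℝ) :
    ∀ᵐ s, s ∈ Ioo (0 : ℝ) 1 →
      der2 (fun s => η s + ε * secondPrimitive ψ s) s = der2 η s + ε * ψ s := by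
  filter_upwards [ae_hasDerivAt_der hη, hψ.ae_hasDerivAt_primitive] with s hs1 hs2 hs
  refine der_eq_of_hasDerivWithinAt ?_ (Ioo_subset_Ico_self hs)
  exact ((hs1 hs).add (hs2.const_mul ε)).hasDerivWithinAt.congr_of_mem
    (fun t ht => der_add_secondPrimitive hη.1 hψ ε ht) (Ioo_subset_Ico_self hs)

theorem add_secondPrimitive_mem_spaceX (hη : η ∈ spaceX) (hψ : IsMomentFree ψ l r) (ε : ℝ) :
    (fun s => η s + ε * secondPrimitive ψ s) ∈ spaceX := by
  refine ⟨hη.1.add (contDiffOn_const.mul (ContDiff.contDiffOn ?_)), ?_⟩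
  · rw [contDiff_one_iff_deriv]
    refine ⟨fun s => (hψ.hasDerivAt_secondPrimitive s).differentiableAt, ?_⟩
    rw [show deriv (secondPrimitive ψ) = _ from
      funext fun s => (hψ.hasDerivAt_secondPrimitive s).deriv]
    exact hψ.continuous_primitive
  · obtain ⟨B, hB⟩ := hψ.bounded
    have hB0 : 0 ≤ B := (abs_nonneg _).trans (hB 0)
    have hL : LipschitzWith (Real.toNNReal (|ε| * B)) fun s => ε * ∫ τ in 0..s, ψ τ := by
      refine LipschitzWith.of_dist_le_mul fun a b => ?_
      rw [Real.coe_toNNReal _ (by positivity), Real.dist_eq, Real.dist_eq, ← mul_sub,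
        intervalIntegral.integral_interval_sub_left hψ.integrable.intervalIntegrable
          hψ.integrable.intervalIntegrable, abs_mul, mul_assoc]
      refine mul_le_mul_of_nonneg_left ?_ (abs_nonneg ε)
      exact intervalIntegral.norm_integral_le_of_norm_le_const
        (C := B) (f := ψ) fun x _ => hB x
    intro s hs
    obtain ⟨K, t, ht, hK⟩ := hη.2 hs
    refine ⟨K + Real.toNNReal (|ε| * B), t ∩ Ico 0 1,
      Filter.inter_mem ht self_mem_nhdsWithin, ?_⟩
    have := (hK.mono (inter_subset_left (t := Ico (0 : ℝ) 1))).add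
      (hL.lipschitzOnWith (s := t ∩ Ico 0 1))
    intro a ha b hb
    rw [der_add_secondPrimitive hη.1 hψ ε ha.2, der_add_secondPrimitive hη.1 hψ ε hb.2]
    exact this ha hb

/-- First-order optimality, in comparison form: where the variation `ψ` of `η''` is positive,
`η''` may be replaced by a larger function and where it is negative by a smaller one. -/
theorem IsDualOptimal.integral_div_sqrt_nonpos (hη : IsDualOptimal ξ h η)
    (hξ : IsRegularMixture ξ) (hl : 0 ≤ l) (hr : r ≤ 1) (hψ : IsMomentFree ψ l r)
    (hadm : ∃ ε₀ > 0, ∀ ε, 0 < ε → ε < ε₀ →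
      ∀ s ∈ Ico (0 : ℝ) 1, ξ s ≤ η s + ε * secondPrimitive ψ s)
    (hv : AEMeasurable v (volume.restrict (Ioo l r))) (hθ : 0 < θ) (hθv : ∀ s ∈ Ioo l r, θ ≤ v s)
    (hcmp : ∀ᵐ s, s ∈ Ioo l r → (0 < ψ s → der2 η s ≤ v s) ∧ (ψ s < 0 → v s ≤ der2 η s)) :
    ∫ s, ψ s / √(v s) ≤ 0 := by
  by_contra! hI
  obtain ⟨ε₀, hε₀, hadm⟩ := hadm
  obtain ⟨B, hB⟩ := hψ.bounded
  have hB0 : 0 ≤ B := (abs_nonneg _).trans (hB 0)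
  have hsθ : 0 < √θ := Real.sqrt_pos.2 hθ
  set I := ∫ s, ψ s / √(v s) with hIdef
  set Q := ∫ s, ψ s ^ 2 with hQ
  have hQ0 : 0 ≤ Q := integral_nonneg fun s => sq_nonneg _
  -- The second bound on `ε` gives `ε ψ ≥ -θ`, keeping the perturbed second derivative non-negative
  -- where `ψ < 0`. The third makes the gain `ε I` exceed the quadratic error.
  obtain ⟨ε, hε, hεlt⟩ : ∃ ε, 0 < ε ∧ ε < min ε₀ (min (θ / (B + 1)) (I * (θ * √θ) / (Q + 1))) :=
    exists_between (lt_min hε₀ (lt_min (by positivity) (by positivity)))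
  have hε1 := hεlt.trans_le (min_le_left _ _)
  have hε2 := (hεlt.trans_le (min_le_right _ _)).trans_le (min_le_left _ _)
  have hε3 := (hεlt.trans_le (min_le_right _ _)).trans_le (min_le_right _ _)
  rw [lt_div_iff₀ (by positivity)] at hε2 hε3
  have hεψ : ∀ s, -θ ≤ ε * ψ s := by
    intro s
    have := (abs_le.1 (hB s)).1
    nlinarith
  have hIoo : Ioo l r ⊆ Ioo 0 1 := Ioo_subset_Ioo hl hr
  set ζ : ℝ → ℝ := fun s => η s + ε * secondPrimitive ψ s with hζdef
  have hnn := hη.1.2.2.2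
  have hder2 := ae_restrict_Ico_of_ae (ae_der2_add_secondPrimitive hη.1.1 hψ ε)
  have hcmp' : ∀ᵐ s ∂volume.restrict (Ico (0 : ℝ) 1),
      s ∈ Ioo l r → (0 < ψ s → der2 η s ≤ v s) ∧ (ψ s < 0 → v s ≤ der2 η s) :=
    ae_restrict_of_ae hcmp
  have hlow : ∀ᵐ s ∂volume.restrict (Ico (0 : ℝ) 1), 0 ≤ der2 η s + ε * ψ s := by
    filter_upwards [hnn, hcmp'] with s hs1 hs2
    by_cases hs : s ∈ Ioo l r
    · rcases lt_or_ge (ψ s) 0 with hneg | hpos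
      · have := (hs2 hs).2 hneg
        linarith [hεψ s, hθv s hs]
      · positivity
    · simpa [hψ.support s hs] using hs1
  have hζ : ζ ∈ admissible ξ h := by
    refine ⟨add_secondPrimitive_mem_spaceX hη.1.1 hψ ε, hadm ε hε hε1, ?_, ?_⟩
    · rw [hζdef, der_add_secondPrimitive hη.1.1.1 hψ ε (by norm_num), hη.1.2.2.1]
      simp
    · filter_upwards [hder2, hlow] with s hs1 hs2
      rw [hs1]
      exact hs2
  set Δ : ℝ → ℝ := fun s => 2 * (√(der2 η s + ε * ψ s) - √(der2 η s)) - ε * ψ s * (1 - s)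
    with hΔdef
  have hΔm : AEMeasurable Δ (volume.restrict (Ico (0 : ℝ) 1)) := by
    have h1 := aemeasurable_der2 η
    have h2 := hψ.measurable
    rw [hΔdef]
    fun_prop
  -- The Hölder bound `|√(u + δ) - √u| ≤ √|δ|` is uniform in `u`, so neither zeros nor growth of
  -- `η''` matter.
  have hΔi : IntegrableOn Δ (Ico 0 1) := by
    refine Integrable.of_bound hΔm.aestronglyMeasurable (2 * √(ε * B) + ε * B) ?_
    filter_upwards [hnn, hlow, ae_restrict_mem measurableSet_Ico] with s hs1 hs2 hs3
    have h1 := abs_sqrt_add_sub_sqrt_le hs1 hs2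
    have h2 : |ε * ψ s| ≤ ε * B := by
      rw [abs_mul, abs_of_pos hε]
      exact mul_le_mul_of_nonneg_left (hB s) hε.le
    have h3 : |ε * ψ s * (1 - s)| ≤ ε * B := by
      rw [abs_mul, abs_of_pos (show 0 < 1 - s by linarith [hs3.2])]
      nlinarith [abs_nonneg (ε * ψ s), hs3.1]
    have h4 := h1.trans (Real.sqrt_le_sqrt h2)
    rw [Real.norm_eq_abs, hΔdef]
    refine (abs_sub _ _).trans (add_le_add ?_ h3)
    rw [abs_mul, abs_two]
    linarith
  have hle := hη.integral_increment_nonpos hξ hζ (by simp [hζdef, secondPrimitive]) hΔi (by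
    filter_upwards [hder2] with s hs
    rw [dualIntegrand, dualIntegrand, hs]
    ring)
  have hψv : Integrable fun s => ψ s / √(v s) := by
    refine (integrableOn_iff_integrable_of_support_subset (s := Ioo l r) fun s hs => ?_).1 ?_
    · by_contra hs'
      exact hs (by simp [hψ.support s hs'])
    · have h1 := hψ.measurable
      refine Integrable.of_bound (AEMeasurable.aestronglyMeasurable (by fun_prop)) (B / √θ) ?_
      filter_upwards [ae_restrict_mem measurableSet_Ioo] with s hs
      rw [norm_div, Real.norm_eq_abs, Real.norm_of_nonneg (Real.sqrt_nonneg _)]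
      have := Real.sqrt_le_sqrt (hθv s hs)
      have := hB s
      gcongr
  have hψ2 : Integrable fun s => ψ s ^ 2 := by
    refine (integrableOn_iff_integrable_of_support_subset (s := Ioo l r) fun s hs => ?_).1 ?_
    · by_contra hs'
      exact hs (by simp [hψ.support s hs'])
    · have h1 := hψ.measurable
      refine Measure.integrableOn_of_bounded (M := B ^ 2) (by simp)
        (AEMeasurable.aestronglyMeasurable (by fun_prop)) ?_
      refine Filter.Eventually.of_forall fun s => ?_
      rw [norm_pow, Real.norm_eq_abs]
      have := hB s
      gcongr
  -- This is `ε (1 - s) ψ`, the change of the linear term in the integrand; its integral vanishes by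
  -- orthogonality to affine functions.
  have haff : Integrable fun s => (ε + -ε * s) * ψ s := hψ.integrable_mul (by fun_prop)
  set R : ℝ → ℝ := fun s => ε * (ψ s / √(v s)) - ε ^ 2 / (θ * √θ) * ψ s ^ 2 - (ε + -ε * s) * ψ s
    with hRdef
  have hRi : Integrable R :=
    ((hψv.const_mul ε).sub (hψ2.const_mul (ε ^ 2 / (θ * √θ)))).sub haff
  have hR : ∫ s in Ico (0 : ℝ) 1, R s = ε * I - ε ^ 2 / (θ * √θ) * Q := by
    rw [setIntegral_eq_integral_of_forall_compl_eq_zero]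
    · have hi1 : Integrable fun s => ε * (ψ s / √(v s)) - ε ^ 2 / (θ * √θ) * ψ s ^ 2 :=
        (hψv.const_mul ε).sub (hψ2.const_mul (ε ^ 2 / (θ * √θ)))
      rw [hRdef, integral_sub hi1 haff, integral_sub (hψv.const_mul ε)
        (hψ2.const_mul (ε ^ 2 / (θ * √θ))), integral_const_mul, integral_const_mul,
        hψ.integral_affine_mul, sub_zero]
    · intro s hs
      have : ψ s = 0 := hψ.support s fun h => hs (Ioo_subset_Ico_self (hIoo h))
      simp [hRdef, this]
  have hRΔ : ∫ s in Ico (0 : ℝ) 1, R s ≤ ∫ s in Ico (0 : ℝ) 1, Δ s := by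
    refine integral_mono_ae hRi.integrableOn hΔi ?_
    filter_upwards [hnn, hcmp'] with s hs1 hs2
    by_cases hs : s ∈ Ioo l r
    · have hle := le_sqrt_add_sub_sqrt_of_comparison hθ (hθv s hs) (hεψ s) hs1
        (fun hp => (hs2 hs).1 (pos_of_mul_pos_right hp hε.le))
        (fun hn => (hs2 hs).2 (by by_contra! hcon; exact not_lt.2 (by positivity) hn))
      have e1 : ε * (ψ s / √(v s)) = 2 * (ε * ψ s / (2 * √(v s))) := by
        rw [mul_div_assoc', mul_div_assoc', mul_div_mul_left _ _ two_ne_zero]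
      have e2 : ε ^ 2 / (θ * √θ) * ψ s ^ 2 = 2 * ((ε * ψ s) ^ 2 / (2 * (θ * √θ))) := by
        field_simp
      simp only [hRdef, hΔdef]
      rw [e1, e2]
      linarith
    · simp [hRdef, hΔdef, hψ.support s hs]
  have hpos : 0 < ε * I - ε ^ 2 / (θ * √θ) * Q := by
    have : ε * Q < I * (θ * √θ) := by nlinarith
    have h2 : ε ^ 2 / (θ * √θ) * Q = ε * (ε * Q / (θ * √θ)) := by ring
    rw [h2, ← mul_sub]
    have h3 : ε * Q / (θ * √θ) < I := by rwa [div_lt_iff₀ (by positivity)]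
    exact mul_pos hε (sub_pos.2 h3)
  linarith

end Variation

/-! ### Proof of the rule of signs -/

section RuleOfSigns

variable {ξ η : ℝ → ℝ} {h a b c d x y p q r : ℝ}

/-- The function `1 / √ξ''`, whose second derivative is `signFn ξ`. -/
noncomputable def invSqrtDeriv2 (ξ : ℝ → ℝ) (t : ℝ) : ℝ := 1 / √(deriv (deriv ξ) t)

theorem IsRegularMixture.contDiffOn_invSqrtDeriv2 (hξ : IsRegularMixture ξ) :
    ContDiffOn ℝ 2 (invSqrtDeriv2 ξ) (Ioo 0 1) := by
  have h1 : ContDiffOn ℝ 2 (deriv (deriv ξ)) (Ioo 0 1) :=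
    hξ.contDiffOn_deriv2.mono fun s hs => ⟨by linarith [hs.1], hs.2⟩
  refine contDiffOn_const.div (h1.sqrt fun s hs => (hξ.deriv2_pos s hs).ne') fun s hs => ?_
  exact (Real.sqrt_pos.2 (hξ.deriv2_pos s hs)).ne'

theorem IsRegularMixture.strictConvexOn_invSqrtDeriv2 (hξ : IsRegularMixture ξ) (ha : 0 ≤ a)
    (hb : b ≤ 1) (hpos : ∀ t ∈ Ioo a b, 0 < signFn ξ t) :
    StrictConvexOn ℝ (Ioo a b) (invSqrtDeriv2 ξ) := by
  refine strictConvexOn_of_deriv2_pos (convex_Ioo a b)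
    (hξ.contDiffOn_invSqrtDeriv2.continuousOn.mono (Ioo_subset_Ioo ha hb)) fun t ht => ?_
  rw [interior_Ioo] at ht
  exact hpos t ht

theorem IsRegularMixture.concaveOn_invSqrtDeriv2 (hξ : IsRegularMixture ξ) (ha : 0 ≤ a)
    (hb : b ≤ 1) (hneg : ∀ t ∈ Ioo a b, signFn ξ t ≤ 0) :
    ConcaveOn ℝ (Ioo a b) (invSqrtDeriv2 ξ) := by
  have hsub : Ioo a b ⊆ Ioo 0 1 := Ioo_subset_Ioo ha hb
  have h2 := hξ.contDiffOn_invSqrtDeriv2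
  have h1 : ContDiffOn ℝ 1 (deriv (invSqrtDeriv2 ξ)) (Ioo 0 1) :=
    h2.deriv_of_isOpen isOpen_Ioo (by norm_num)
  refine concaveOn_of_deriv2_nonpos (convex_Ioo a b) (h2.continuousOn.mono hsub) ?_ ?_ ?_
  · rw [interior_Ioo]
    exact (h2.differentiableOn (by norm_num)).mono hsub
  · rw [interior_Ioo]
    exact (h1.differentiableOn (by norm_num)).mono hsub
  · rw [interior_Ioo]
    exact hneg

/-- The left endpoint must stay away from `0`, where `ξ''` may vanish. -/
theorem IsRegularMixture.exists_pos_le_deriv2 (hξ : IsRegularMixture ξ) (hx : 0 < x)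
    (hy : y < 1) : ∃ θ > 0, ∀ s ∈ Ioo x y, θ ≤ deriv (deriv ξ) s := by
  rcases le_or_gt x y with hxy | hxy
  · obtain ⟨t, ht, hmin⟩ := isCompact_Icc.exists_isMinOn (nonempty_Icc.2 hxy)
      (hξ.continuousOn_deriv2.mono fun s (hs : s ∈ Icc x y) =>
        ⟨by linarith [hs.1], by linarith [hs.2]⟩)
    exact ⟨_, hξ.deriv2_pos t ⟨by linarith [ht.1], by linarith [ht.2]⟩,
      fun s hs => hmin (Ioo_subset_Icc_self hs)⟩
  · exact ⟨1, one_pos, fun s hs => by linarith [hs.1, hs.2]⟩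

/-- Measurability is inherited from `deriv (der η)`, which agrees with `der2 η` on the open
interval. -/
theorem measurableSet_der2_inter_Ioo {P : ℝ → ℝ → Prop} (hx : 0 ≤ x) (hy : y ≤ 1)
    (hP : MeasurableSet {s | P (deriv (der η) s) (deriv (deriv ξ) s)}) :
    MeasurableSet ({s | P (der2 η s) (deriv (deriv ξ) s)} ∩ Ioo x y) := by
  convert hP.inter (measurableSet_Ioo (a := x) (b := y)) using 1
  ext s
  refine and_congr_left fun hs => ?_
  rw [mem_ofPred_eq, mem_ofPred_eq, der2_eq_deriv η (Ioo_subset_Ioo hx hy hs)]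

theorem measurable_deriv_der_deriv2 (ξ η : ℝ → ℝ) :
    Measurable (deriv (der η)) ∧ Measurable (deriv (deriv ξ)) :=
  ⟨measurable_deriv _, measurable_deriv _⟩

/-- Where `1 / √ξ''` is strictly convex, there are no three points of coincidence. -/
theorem IsDualOptimal.not_three_coincidences (hη : IsDualOptimal ξ h η) (hξ : IsRegularMixture ξ)
    (ha : 0 ≤ a) (hb : b < 1) (hpos : ∀ t ∈ Ioo a b, 0 < signFn ξ t)
    (hap : a ≤ p) (hpq : p < q) (hqr : q < r) (hrb : r ≤ b)
    (hp : η p = ξ p) (hq : η q = ξ q) (hr : η r = ξ r) : False := by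
  have hX := hη.1.1
  obtain ⟨m, ⟨hpm, hmq⟩, hWm⟩ := exists_hasDerivAt_eq_zero (f := fun s => η s - ξ s)
    (f' := gapSlope ξ η) hpq
    ((continuousOn_gap hξ hX).mono fun s hs => ⟨by linarith [hs.1], by linarith [hs.2]⟩)
    (by simp [hp, hq])
    (fun s hs => hasDerivAt_gap hξ hX ⟨by linarith [hs.1], by linarith [hs.2]⟩)
  obtain ⟨n, ⟨hqn, hnr⟩, hWn⟩ := exists_hasDerivAt_eq_zero (f := fun s => η s - ξ s)
    (f' := gapSlope ξ η) hqr
    ((continuousOn_gap hξ hX).mono fun s hs => ⟨by linarith [hs.1], by linarith [hs.2]⟩)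
    (by simp [hq, hr])
    (fun s hs => hasDerivAt_gap hξ hX ⟨by linarith [hs.1], by linarith [hs.2]⟩)
  have hWq : gapSlope ξ η q = 0 :=
    gapSlope_eq_zero hξ hη.1 ⟨by linarith, by linarith⟩ hq
  obtain ⟨l, x, hml, hlx, hxq, hA0⟩ := exists_Ioo_measure_inter_ne_zero
    (measure_der2_le_ne_zero hξ hX (by linarith) hmq (by linarith) (by rw [hWq, hWm]))
  obtain ⟨z, k, hqz, hzk, hkn, hC0⟩ := exists_Ioo_measure_inter_ne_zero
    (measure_der2_le_ne_zero hξ hX (by linarith) hqn (by linarith) (by rw [hWq, hWn]))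
  -- The gap vanishes at `q` and is non-negative at `z`, so its slope is non-negative at some `t` in
  -- `(q, z)`. As the slope vanishes at `q`, it does not decrease from `q` to `t`.
  have hK0 : volume ({s | deriv (deriv ξ) s ≤ der2 η s} ∩ Ioo x z) ≠ 0 := by
    intro h0
    obtain ⟨t, ht, hslope⟩ := exists_hasDerivAt_eq_slope (fun s => η s - ξ s) (gapSlope ξ η) hqz
      ((continuousOn_gap hξ hX).mono fun s hs => ⟨by linarith [hs.1], by linarith [hs.2]⟩)
      (fun s hs => hasDerivAt_gap hξ hX ⟨by linarith [hs.1], by linarith [hs.2]⟩)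
    have hWt : 0 ≤ gapSlope ξ η t := by
      rw [hslope]
      have := hη.1.2.1 z ⟨by linarith, by linarith⟩
      apply div_nonneg <;> linarith
    refine measure_le_der2_ne_zero hξ hX (by linarith) ht.1 (by linarith [ht.2])
      (by rwa [hWq]) (measure_mono_null (inter_subset_inter_right _ ?_) h0)
    exact Ioo_subset_Ioo hxq.le ht.2.le
  obtain ⟨hm1, hm2⟩ := measurable_deriv_der_deriv2 ξ η
  obtain ⟨ψ, hψ, hψpos, hψneg⟩ := exists_isConvexityTest (hxq.trans hqz)
    (measurableSet_der2_inter_Ioo (P := fun u v => u ≤ v) (by linarith) (by linarith)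
      (measurableSet_le hm1 hm2))
    (measurableSet_der2_inter_Ioo (P := fun u v => v ≤ u) (by linarith) (by linarith)
      (measurableSet_le hm2 hm1))
    (measurableSet_der2_inter_Ioo (P := fun u v => u ≤ v) (by linarith) (by linarith)
      (measurableSet_le hm1 hm2))
    hA0 hK0 hC0 inter_subset_right inter_subset_right inter_subset_right
  obtain ⟨θ, hθ, hθv⟩ := hξ.exists_pos_le_deriv2 (show 0 < l by linarith) (show k < 1 by linarith)
  have hle := hη.integral_div_sqrt_nonpos hξ (show 0 ≤ l by linarith) (show k ≤ 1 by linarith)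
    hψ.toIsMomentFree
    ⟨1, one_pos, fun ε hε _ s hs => by
      have h1 := hη.1.2.1 s hs
      have h2 := hψ.secondPrimitive_nonneg (hxq.trans hqz) (show 0 ≤ l by linarith) hs.1
      have := mul_nonneg hε.le h2
      linarith⟩
    hm2.aemeasurable hθ hθv
    (Filter.Eventually.of_forall fun s _ =>
      ⟨fun hs => (hψpos s hs).elim (fun h => h.1) (fun h => h.1), fun hs => ((hψneg s).1 hs).1⟩)
  have hlt := hψ.integral_mul_pos (hξ.strictConvexOn_invSqrtDeriv2 ha hb.le hpos)
    (hξ.contDiffOn_invSqrtDeriv2.continuousOn.mono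
      fun s hs => ⟨by linarith [hs.1], by linarith [hs.2]⟩)
    ⟨by linarith, by linarith⟩ ⟨by linarith, by linarith⟩ (hxq.trans hqz)
    (Ioo_subset_Ioo (by linarith) (by linarith))
  have heq : ∀ s, invSqrtDeriv2 ξ s * ψ s = ψ s / √(deriv (deriv ξ) s) := fun s => by
    rw [invSqrtDeriv2]
    ring
  simp_rw [heq] at hlt
  linarith

/-- A strict pointwise inequality becomes a uniform factor by taking the countable union over `ρ = 1
- 1 / (n + 2)`; the shift by two keeps `ρ` positive. -/
theorem exists_ratio_measure_ne_zero (hξ : IsRegularMixture ξ) (hx : 0 ≤ x) (hy : y ≤ 1)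
    (h0 : volume ({s | der2 η s < deriv (deriv ξ) s} ∩ Ioo x y) ≠ 0) :
    ∃ ρ, 0 < ρ ∧ ρ < 1 ∧ volume ({s | der2 η s ≤ ρ * deriv (deriv ξ) s} ∩ Ioo x y) ≠ 0 := by
  by_contra! hcon
  apply h0
  have hsub : {s | der2 η s < deriv (deriv ξ) s} ∩ Ioo x y ⊆
      ⋃ n : ℕ, {s | der2 η s ≤ (1 - 1 / ((n : ℝ) + 2)) * deriv (deriv ξ) s} ∩ Ioo x y := by
    rintro s ⟨hs, hsI⟩
    rw [mem_ofPred_eq] at hs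
    have hpos := hξ.deriv2_pos s (Ioo_subset_Ioo hx hy hsI)
    obtain ⟨n, hn⟩ := exists_nat_one_div_lt (div_pos (sub_pos.2 hs) hpos)
    have hn2 : 1 / ((n : ℝ) + 2) ≤ 1 / (n + 1) := by
      apply one_div_le_one_div_of_le <;> [positivity; linarith]
    have h3 := hn2.trans hn.le
    rw [le_div_iff₀ hpos] at h3
    refine mem_iUnion.2 ⟨n, ?_, hsI⟩
    rw [mem_ofPred_eq]
    linarith
  refine measure_mono_null hsub (measure_iUnion_null fun n => hcon _ ?_ ?_)
  · have : 1 / ((n : ℝ) + 2) < 1 := by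
      rw [div_lt_one (by positivity)]
      have : (0 : ℝ) ≤ n := by positivity
      linarith
    linarith
  · have : 0 < 1 / ((n : ℝ) + 2) := by positivity
    linarith

/-- Where `1 / √ξ''` is concave, two points of coincidence do not bound an interval of
non-coincidence. -/
theorem IsDualOptimal.not_gap (hη : IsDualOptimal ξ h η) (hξ : IsRegularMixture ξ)
    (ha : 0 ≤ a) (hb : b < 1) (hneg : ∀ t ∈ Ioo a b, signFn ξ t ≤ 0)
    (hac : a ≤ c) (hcd : c < d) (hdb : d ≤ b) (hc : η c = ξ c) (hd : η d = ξ d)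
    (hgap : ∀ s ∈ Ioo c d, ξ s < η s) : False := by
  have hX := hη.1.1
  have hcont : ∀ {x y : ℝ}, c ≤ x → y ≤ d → ContinuousOn (fun s => η s - ξ s) (Icc x y) :=
    fun hx hy => (continuousOn_gap hξ hX).mono
      fun s hs => ⟨by linarith [hs.1], by linarith [hs.2]⟩
  have hder : ∀ {x y : ℝ}, c ≤ x → y ≤ d → ∀ s ∈ Ioo x y,
      HasDerivAt (fun s => η s - ξ s) (gapSlope ξ η s) s :=
    fun hx hy s hs => hasDerivAt_gap hξ hX ⟨by linarith [hs.1], by linarith [hs.2]⟩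
  have hWc : gapSlope ξ η c ≤ 0 := by
    rcases (ha.trans hac).eq_or_lt with h0 | h0
    · rw [← h0]
      exact gapSlope_zero_nonpos hξ hη.1
    · exact (gapSlope_eq_zero hξ hη.1 ⟨h0, by linarith⟩ hc).le
  have hWd : gapSlope ξ η d = 0 := gapSlope_eq_zero hξ hη.1 ⟨by linarith, by linarith⟩ hd
  obtain ⟨m, ⟨hcm, hmd⟩, hWm⟩ := exists_hasDerivAt_eq_zero (f := fun s => η s - ξ s)
    (f' := gapSlope ξ η) hcd (hcont le_rfl le_rfl) (by simp [hc, hd]) (hder le_rfl le_rfl)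
  have hgm := hgap m ⟨hcm, hmd⟩
  obtain ⟨x, ⟨hcx, hxm⟩, hWx⟩ := exists_hasDerivAt_eq_slope (fun s => η s - ξ s) (gapSlope ξ η)
    hcm (hcont le_rfl hmd.le) (hder le_rfl hmd.le)
  obtain ⟨y, ⟨hmy, hyd⟩, hWy⟩ := exists_hasDerivAt_eq_slope (fun s => η s - ξ s) (gapSlope ξ η)
    hmd (hcont hcm.le le_rfl) (hder hcm.le le_rfl)
  replace hWx : 0 < gapSlope ξ η x := by
    rw [hWx]
    apply div_pos <;> linarith
  replace hWy : gapSlope ξ η y < 0 := by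
    rw [hWy]
    apply div_neg_of_neg_of_pos <;> linarith
  -- The slope is non-positive at `c`, positive at `x`, zero at `m`, negative at `y` and zero at
  -- `d`. It rises on `(c, x)` and `(y, d)` and falls on `(x, m)`, which provides the three sets.
  obtain ⟨l, x', hcl, hlx', hx'x, hA0⟩ := exists_Ioo_measure_inter_ne_zero
    (measure_lt_der2_ne_zero hξ hX (by linarith) hcx (by linarith) (by linarith))
  obtain ⟨y', k, hyy', hy'k, hkd, hC0⟩ := exists_Ioo_measure_inter_ne_zero
    (measure_lt_der2_ne_zero hξ hX (by linarith) hyd (by linarith) (by linarith))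
  obtain ⟨ρ, hρ0, hρ1, hK0⟩ := exists_ratio_measure_ne_zero hξ (by linarith) (by linarith)
    (measure_der2_lt_ne_zero hξ hX (by linarith) hxm (by linarith) (by linarith))
  obtain ⟨hm1, hm2⟩ := measurable_deriv_der_deriv2 ξ η
  set K := {s | der2 η s ≤ ρ * deriv (deriv ξ) s} ∩ Ioo x m with hKdef
  have hKm : MeasurableSet K :=
    measurableSet_der2_inter_Ioo (P := fun u v => u ≤ ρ * v) (by linarith) (by linarith)
      (measurableSet_le hm1 (hm2.const_mul ρ))
  obtain ⟨ψ, hψ, hψpos, hψneg⟩ := exists_isConvexityTest hxm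
    (measurableSet_der2_inter_Ioo (P := fun u v => v < u) (by linarith) (by linarith)
      (measurableSet_lt hm2 hm1))
    hKm
    (measurableSet_der2_inter_Ioo (P := fun u v => v < u) (by linarith) (by linarith)
      (measurableSet_lt hm2 hm1))
    hA0 hK0 hC0 (inter_subset_right.trans (Ioo_subset_Ioo_right hx'x.le)) inter_subset_right
    (inter_subset_right.trans (Ioo_subset_Ioo_left (hmy.trans hyy').le))
  have hl0 : 0 < l := by linarith
  have hk1 : k < 1 := by linarith
  have hlk : l < k := by linarith
  obtain ⟨θ, hθ, hθv⟩ := hξ.exists_pos_le_deriv2 hl0 hk1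
  classical
  -- The factor `ρ` is affordable on `K`, where `-ψ > 0` and `η'' ≤ ρ ξ''`. Elsewhere `-ψ` is
  -- negative only where `η'' > ξ''`.
  set v : ℝ → ℝ := fun s => if s ∈ K then ρ * deriv (deriv ξ) s else deriv (deriv ξ) s with hvdef
  have hvm : Measurable v := Measurable.ite hKm (hm2.const_mul ρ) hm2
  have hadm : ∃ ε₀ > 0, ∀ ε, 0 < ε → ε < ε₀ →
      ∀ s ∈ Ico (0 : ℝ) 1, ξ s ≤ η s + ε * secondPrimitive (fun s => -ψ s) s := by
    have hφneg : ∀ s, secondPrimitive (fun s => -ψ s) s = -secondPrimitive ψ s := fun s => by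
      simp [secondPrimitive, intervalIntegral.integral_neg]
    obtain ⟨t, ht, htmin⟩ := isCompact_Icc.exists_isMinOn (nonempty_Icc.2 hlk.le)
      (hcont hcl.le hkd.le)
    have hgt := hgap t ⟨by linarith [ht.1], by linarith [ht.2]⟩
    have hφc : Continuous (secondPrimitive ψ) := continuous_iff_continuousAt.2 fun s =>
      (hψ.hasDerivAt_secondPrimitive s).continuousAt
    obtain ⟨M, hM⟩ := (isCompact_Icc (a := l) (b := k)).bddAbove_image hφc.continuousOn
    have hM0 : 0 ≤ |M| := abs_nonneg M
    -- The minimum of `η - ξ` over `[l, k]` is positive and outweighs `ε φ`; outside `(l, k)` the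
    -- variation vanishes.
    refine ⟨(η t - ξ t) / (|M| + 1), div_pos (by linarith) (by positivity), ?_⟩
    intro ε hε hε1 s hs
    rw [lt_div_iff₀ (by positivity)] at hε1
    rw [hφneg]
    by_cases hsI : s ∈ Ioo l k
    · have h1 : η t - ξ t ≤ η s - ξ s := htmin (Ioo_subset_Icc_self hsI)
      have h2 : secondPrimitive ψ s ≤ M := hM ⟨s, Ioo_subset_Icc_self hsI, rfl⟩
      nlinarith [le_abs_self M]
    · rw [hψ.secondPrimitive_eq_zero hl0.le hs.1 hsI]
      have := hη.1.2.1 s hs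
      linarith
  have hle := hη.integral_div_sqrt_nonpos hξ hl0.le hk1.le hψ.toIsMomentFree.neg hadm
    hvm.aemeasurable (mul_pos hρ0 hθ) (fun s hs => by
      have h1 := hθv s hs
      simp only [hvdef]
      split_ifs
      · exact mul_le_mul_of_nonneg_left h1 hρ0.le
      · nlinarith)
    (Filter.Eventually.of_forall fun s _ => by
      refine ⟨fun hs => ?_, fun hs => ?_⟩
      · have hsK : s ∈ K := (hψneg s).1 (by linarith)
        simp only [hvdef, if_pos hsK]
        exact hsK.1
      · have hs0 : 0 < ψ s := by linarith
        have hsK : s ∉ K := fun h => by linarith [(hψneg s).2 h]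
        simp only [hvdef, if_neg hsK]
        exact (hψpos s hs0).elim (fun h => (h.1 : _ < _).le) (fun h => (h.1 : _ < _).le))
  have hfc : ContinuousOn (fun s => -invSqrtDeriv2 ξ s) (Icc l k) :=
    (hξ.contDiffOn_invSqrtDeriv2.continuousOn.mono
      fun s hs => ⟨by linarith [hs.1], by linarith [hs.2]⟩).neg
  have hge := hψ.integral_mul_nonneg (hξ.concaveOn_invSqrtDeriv2 ha hb.le hneg).neg hfc
    ⟨by linarith, by linarith⟩ ⟨by linarith, by linarith⟩ hxm
    (Ioo_subset_Ioo (by linarith) (by linarith))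
  simp only [Pi.neg_apply] at hge
  have hi := hψ.integrable_mul hfc
  have hKpos : 0 < ∫ s in K, -invSqrtDeriv2 ξ s * ψ s := by
    refine setIntegral_pos_of_pos hKm hK0 hi.integrableOn fun s hs => ?_
    have h1 := (hψneg s).2 hs
    have h2 : 0 < invSqrtDeriv2 ξ s := by
      have := hξ.deriv2_pos s ⟨by linarith [hs.2.1], by linarith [hs.2.2]⟩
      unfold invSqrtDeriv2
      positivity
    nlinarith
  -- Splitting off the surplus created by `ρ`: the first term has non-negative integral by
  -- concavity, and the second is strictly positive on `K`.
  have heq : ∀ s, -ψ s / √(v s) = -invSqrtDeriv2 ξ s * ψ s +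
      (1 / √ρ - 1) * K.indicator (fun s => -invSqrtDeriv2 ξ s * ψ s) s := by
    intro s
    by_cases hs : s ∈ K
    · simp only [hvdef, if_pos hs, indicator_of_mem hs, Real.sqrt_mul hρ0.le, invSqrtDeriv2]
      ring
    · simp only [hvdef, if_neg hs, indicator_of_notMem hs, invSqrtDeriv2]
      ring
  simp_rw [heq] at hle
  rw [integral_add hi ((hi.indicator hKm).const_mul _), integral_const_mul,
    integral_indicator hKm] at hle
  have hρ : 0 < 1 / √ρ - 1 := by
    rw [sub_pos, lt_div_iff₀ (Real.sqrt_pos.2 hρ0), one_mul, Real.sqrt_lt' one_pos]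
    linarith
  have := mul_pos hρ hKpos
  linarith

end RuleOfSigns

theorem theorem3 (β : ℝ) (hβ : β ≠ 0) (c : ℕ → ℝ) (hc : ∃ p : ℕ, 2 ≤ p ∧ c p ≠ 0)
    (hconv : ∃ ε : ℝ, 0 < ε ∧ Summable fun p : ℕ => c (p + 2) ^ 2 * (1 + ε) ^ (p + 2))
    (h : ℝ) (hh : 0 ≤ h) (η : ℝ → ℝ) (hη : IsDualOptimal (mixture β c) h η)
    (a b : ℝ) (ha : 0 ≤ a) (hab : a < b) (hb : b < 1) :
    ((∀ t ∈ Ioo a b, 0 < signFn (mixture β c) t) →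
      (coincidenceSet (mixture β c) η ∩ Icc a b).encard ≤ 2) ∧
    ((∀ t ∈ Icc a b, signFn (mixture β c) t ≤ 0) →
      a ∈ coincidenceSet (mixture β c) η → b ∈ coincidenceSet (mixture β c) η →
      Icc a b ⊆ coincidenceSet (mixture β c) η) := by
  have hξ := isRegularMixture_mixture β hβ c hc hconv
  set ξ := mixture β c with hξdef
  refine ⟨fun hpos => ?_, fun hneg haC hbC s hs => ?_⟩
  · by_contra! hcard
    have h3 : (3 : ℕ∞) ≤ (coincidenceSet ξ η ∩ Icc a b).encard := by
      have := Order.add_one_le_of_lt hcard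
      norm_num at this
      exact this
    obtain ⟨t, ht, ht3⟩ := exists_subset_encard_eq h3
    obtain ⟨p, q, r, hpq, hpr, hqr, rfl⟩ := encard_eq_three.1 ht3
    have key : ∀ p ∈ coincidenceSet ξ η ∩ Icc a b, ∀ q ∈ coincidenceSet ξ η ∩ Icc a b,
        ∀ r ∈ coincidenceSet ξ η ∩ Icc a b, p < q → q < r → False :=
      fun p hp q hq r hr hpq hqr => hη.not_three_coincidences hξ ha hb hpos hp.2.1 hpq hqr hr.2.2
        hp.1.2 hq.1.2 hr.1.2
    have hp := ht (show p ∈ ({p, q, r} : Set ℝ) by simp)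
    have hq := ht (show q ∈ ({p, q, r} : Set ℝ) by simp)
    have hr := ht (show r ∈ ({p, q, r} : Set ℝ) by simp)
    rcases lt_or_gt_of_ne hpq with h1 | h1 <;> rcases lt_or_gt_of_ne hpr with h2 | h2 <;>
      rcases lt_or_gt_of_ne hqr with h3 | h3
    · exact key p hp q hq r hr h1 h3
    · exact key p hp r hr q hq h2 h3
    · exact lt_asymm (h1.trans h3) h2
    · exact key r hr p hp q hq h2 h1
    · exact key q hq p hp r hr h1 h2
    · exact lt_asymm (h1.trans h2) h3
    · exact key q hq r hr p hp h3 h2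
    · exact key r hr q hq p hp h3 h1
  · have hs01 : s ∈ Ico (0 : ℝ) 1 := ⟨ha.trans hs.1, hs.2.trans_lt hb⟩
    refine ⟨hs01, ?_⟩
    by_contra hne
    have hcont : ContinuousOn (fun s => η s - ξ s) (Icc a b) :=
      (continuousOn_gap hξ hη.1.1).mono fun t ht => ⟨ha.trans ht.1, ht.2.trans_lt hb⟩
    have hcompact : ∀ {x y : ℝ}, a ≤ x → y ≤ b →
        IsCompact (Icc x y ∩ (fun s => η s - ξ s) ⁻¹' {0}) := fun hx hy =>
      isCompact_Icc.of_isClosed_subset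
        ((hcont.mono (Icc_subset_Icc hx hy)).preimage_isClosed_of_isClosed isClosed_Icc
          isClosed_singleton) inter_subset_left
    -- The coincidences nearest to `s` on the left and on the right bound an interval free of
    -- coincidences, to which `not_gap` applies.
    obtain ⟨l, ⟨hlI, hl0⟩, hlmax⟩ := (hcompact le_rfl hs.2).exists_isGreatest
      ⟨a, left_mem_Icc.2 hs.1, by simp [haC.2]⟩
    obtain ⟨r, ⟨hrI, hr0⟩, hrmin⟩ := (hcompact hs.1 le_rfl).exists_isLeast
      ⟨b, right_mem_Icc.2 hs.2, by simp [hbC.2]⟩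
    replace hl0 : η l = ξ l := sub_eq_zero.1 hl0
    replace hr0 : η r = ξ r := sub_eq_zero.1 hr0
    have hls : l < s := lt_of_le_of_ne hlI.2 fun h => hne (h ▸ hl0)
    have hsr : s < r := lt_of_le_of_ne hrI.1 fun h => hne (h ▸ hr0)
    refine hη.not_gap hξ ha hb (fun t ht => hneg t (Ioo_subset_Icc_self ht)) hlI.1
      (hls.trans hsr) hrI.2 hl0 hr0 fun t ht => ?_
    have hat := hlI.1
    have hrb := hrI.2
    refine lt_of_le_of_ne (hη.1.2.1 t ⟨by linarith [ht.1], by linarith [ht.2]⟩) fun heq => ?_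
    rcases le_total t s with hts | hst
    · have : t ≤ l := hlmax ⟨⟨by linarith [ht.1], hts⟩, by simp [heq]⟩
      linarith [ht.1]
    · have : r ≤ t := hrmin ⟨⟨hst, by linarith [ht.2]⟩, by simp [heq]⟩
      linarith [ht.2]
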